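/- Let $d\in\mathbb N$ and let $\Omega\subset\mathbb R^d$ be an arbitrary open set. **Colombeau algebra.** For compact $K\subset\Omega$, $l\in\mathbb N$ put $p_{K,l}(f)=\sup_{x\in K,|\alpha|\le l}|\partial^\alpha f(x)|$. Let $\mathcal F(\Omega)$ be the algebra of nets $(f_\varepsilon)_{\varepsilon\in(0,1]}$ in $C^\infty(\Omega;\mathbb C)$ such that for all $K,l$ there is $q\in\mathbb N$ with $p_{K,l}(f_\varepsilon)=o(\varepsilon^{-q})$ as $\varepsilon\to0$, let $\mathcal N(\Omega)$ be the ideal of nets such that $p_{K,l}(f_\varepsilon)=o(\varepsilon^{p})$ for all $K,l$ and all $p\in\mathbb N$, and let $\mathcal G(\Omega)=\mathcal F(\Omega)/\mathcal N(\Omega)$, with the obvious restriction maps $\mathcal G(\Omega)\to\mathcal G(\Omega')$ for open $\Omega'\subset\Omega$. **Mollifiers.** Let $\rho\in\mathcal S(\mathbb R^d)$ be even with $\int\rho=1$ and $\int x^m\rho(x)\,dx=0$ for all $m\in\mathbb N^d\setminus\{0\}$. Let $\chi\in\mathcal D(\mathbb R^d)$ with $0\le\chi\le1$, $\chi=1$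 on $\overline{B(0,1)}$ and $\chi=0$ off $B(0,2)$. Put $\rho_\varepsilon(x)=\varepsilon^{-d}\rho(x/\varepsilon)$ for $\varepsilon\in(0,1]$, $\theta_\varepsilon(x)=\rho_\varepsilon(x)\,\chi(x|\ln\varepsilon|)$ for $\varepsilon\in(0,1)$, and $\theta_1=1$. **The map $\iota_A$.** Let $(U_\lambda)_\lambda$ be a locally finite (in $\Omega$) open covering of $\Omega$ such that each $\overline{U_\lambda}$ is a compact subset of $\Omega$, and let $\psi_\lambda\in\mathcal D(\Omega)$ with $0\le\psi_\lambda\le1$ and $\psi_\lambda=1$ on a neighbourhood of $\overline{U_\lambda}$. Then $\iota_A:\mathcal D'(\Omega)\to\mathcal G(\Omega)$ is the map determined by $\iota_A(T)|_{U_\lambda}=\big[\big(((\psi_\lambda T)*\rho_\varepsilon)|_{U_\lambda}\big)_\varepsilon\big]$ in $\mathcal G(U_\lambda)$ for all $\lambda$ and $T$. **The map $\iota_S$.** For $\varepsilon\in(0,1]$ let $K_\varepsilon=\{x\in\Omega: d(x,\mathbb R^d\setminus\Omega)\ge\varepsilon,\ |x|\le1/\varepsilon\}$ (with $d(x,\emptyset)=\infty$),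 and let $\kappa_\varepsilon\in\mathcal D(\Omega)$ with $0\le\kappa_\varepsilon\le1$ and $\kappa_\varepsilon=1$ on $K_\varepsilon$. Then $\iota_S(T)=\big[\big((\kappa_\varepsilon T)*\theta_\varepsilon\big)_\varepsilon\big]$ in $\mathcal G(\Omega)$. **The map $\iota_S'$.** Let $(V_\mu)_\mu$ be a locally finite (in $\Omega$) open covering of $\Omega$ such that each $\overline{V_\mu}$ is a compact subset of $\Omega$, and let $e_\mu\in(0,1]$ be such that $\theta_\varepsilon(y-\cdot)\in\mathcal D(\Omega)$ for all $\varepsilon\in(0,e_\mu^2]$ and $y\in V_\mu$. For $T\in\mathcal D'(\Omega)$ and $y\in V_\mu$ put $T^\mu_\varepsilon(y)=\langle T,\theta_\varepsilon(y-\cdot)\rangle$ for $\varepsilon\in(0,e_\mu^2]$ and $T^\mu_\varepsilon=T^\mu_{e_\mu^2}$ for $\varepsilon\in(e_\mu^2,1]$. Then $\iota_S':\mathcal D'(\Omega)\to\mathcal G(\Omega)$ is the map determined by $\iota_S'(T)|_{V_\mu}=[(T^\mu_\varepsilon)_\varepsilon]$ in $\mathcal G(V_\mu)$ for all $\mu$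 and $T$. **Proposition.** For every choice of the above data with the same $\rho$, each of the three prescriptions is well defined (the nets involved are moderate) and determines exactly one map $\mathcal D'(\Omega)\to\mathcal G(\Omega)$; these maps are linear, and $$\iota_A=\iota_S=\iota_S'.$$ -/

import Mathlib

open Set Topology TopologicalSpace MeasureTheory
open scoped ContDiff

namespace Colombeau

/-- The space `ℝ^d` with its Euclidean norm. -/
abbrev Space (d : ℕ) : Type := EuclideanSpace ℝ (Fin d)

/-- The parameter set `(0, 1]`. -/
abbrev Eps : Type := Set.Ioc (0 : ℝ) 1

/-- Nets `(f_ε)`, `ε ∈ (0, 1]`, of functions. A function on an open set `Ω` is represented by a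
function on `ℝ^d` whose values outside `Ω` are never looked at (see `moderate`, `negligible`). -/
abbrev Net (d : ℕ) : Type := Eps → Space d → ℂ

/-- `p_{K,l}(f_ε) = o(ε ^ r)` for `ε → 0`, where `p_{K,l}(f)` is the supremum over `K` of the norms
of all derivatives of `f` of order at most `l`. -/
def SeminormLittleO {d : ℕ} (K : Set (Space d)) (l : ℕ) (f : Net d) (r : ℤ) : Prop :=
  ∀ c : ℝ, 0 < c → ∃ η : ℝ, 0 < η ∧ ∀ ε : Eps, (ε : ℝ) < η → ∀ i ≤ l, ∀ x ∈ K,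
    ‖iteratedFDeriv ℝ i (f ε) x‖ ≤ c * (ε : ℝ) ^ r

/-- Moderate nets of smooth functions on `Ω`. -/
def IsModerate {d : ℕ} (Ω : Opens (Space d)) (f : Net d) : Prop :=
  (∀ ε, ContDiffOn ℝ ∞ (f ε) (Ω : Set (Space d))) ∧
    ∀ (l : ℕ) (K : Set (Space d)), IsCompact K → K ⊆ Ω → ∃ q : ℕ, SeminormLittleO K l f (-(q : ℤ))

/-- Negligible nets of smooth functions on `Ω`. -/
def IsNegligible {d : ℕ} (Ω : Opens (Space d)) (f : Net d) : Prop :=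
  (∀ ε, ContDiffOn ℝ ∞ (f ε) (Ω : Set (Space d))) ∧
    ∀ (l : ℕ) (K : Set (Space d)), IsCompact K → K ⊆ Ω → ∀ p : ℕ, SeminormLittleO K l f (p : ℤ)

section Algebra

variable {d : ℕ} {Ω Ω' : Opens (Space d)} {K : Set (Space d)} {l : ℕ} {f g : Net d}

theorem SeminormLittleO.mono {r s : ℤ} (h : SeminormLittleO K l f r) (hrs : s ≤ r) :
    SeminormLittleO K l f s := by
  intro c hc
  obtain ⟨η, hη, H⟩ := h c hc
  refine ⟨η, hη, fun ε hε i hi x hx => (H ε hε i hi x hx).trans ?_⟩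
  exact mul_le_mul_of_nonneg_left (zpow_le_zpow_right_of_le_one₀ ε.2.1 ε.2.2 hrs) hc.le

theorem SeminormLittleO.add (hK : K ⊆ Ω)
    (hf : ∀ ε, ContDiffOn ℝ ∞ (f ε) (Ω : Set (Space d)))
    (hg : ∀ ε, ContDiffOn ℝ ∞ (g ε) (Ω : Set (Space d))) {r : ℤ}
    (h : SeminormLittleO K l f r) (h' : SeminormLittleO K l g r) :
    SeminormLittleO K l (f + g) r := by
  intro c hc
  obtain ⟨η, hη, H⟩ := h (c / 2) (by positivity)
  obtain ⟨η', hη', H'⟩ := h' (c / 2) (by positivity)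
  refine ⟨min η η', lt_min hη hη', fun ε hε i hi x hx => ?_⟩
  have hx' : (Ω : Set (Space d)) ∈ 𝓝 x := Ω.isOpen.mem_nhds (hK hx)
  have e : iteratedFDeriv ℝ i ((f + g) ε) x
      = iteratedFDeriv ℝ i (f ε) x + iteratedFDeriv ℝ i (g ε) x :=
    iteratedFDeriv_add_apply
      (((hf ε).contDiffAt hx').of_le (by exact_mod_cast le_top))
      (((hg ε).contDiffAt hx').of_le (by exact_mod_cast le_top))
  have h1 := H ε (hε.trans_le (min_le_left _ _)) i hi x hx
  have h2 := H' ε (hε.trans_le (min_le_right _ _)) i hi x hx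
  rw [e]
  refine (norm_add_le _ _).trans ((add_le_add h1 h2).trans (le_of_eq ?_))
  ring

theorem SeminormLittleO.mul (hK : K ⊆ Ω)
    (hf : ∀ ε, ContDiffOn ℝ ∞ (f ε) (Ω : Set (Space d)))
    (hg : ∀ ε, ContDiffOn ℝ ∞ (g ε) (Ω : Set (Space d))) {r s : ℤ}
    (h : SeminormLittleO K l f r) (h' : SeminormLittleO K l g s) :
    SeminormLittleO K l (f * g) (r + s) := by
  intro c hc
  obtain ⟨η, hη, H⟩ := h (c / 2 ^ l) (by positivity)
  obtain ⟨η', hη', H'⟩ := h' 1 one_pos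
  refine ⟨min η η', lt_min hη hη', fun ε hε i hi x hx => ?_⟩
  have hxΩ : x ∈ (Ω : Set (Space d)) := hK hx
  have h0 : (0 : ℝ) < ε := ε.2.1
  have e : ∀ (j : ℕ) (u : Space d → ℂ),
      iteratedFDerivWithin ℝ j u Ω x = iteratedFDeriv ℝ j u x := fun j u =>
    iteratedFDerivWithin_of_isOpen j Ω.isOpen hxΩ
  have key := norm_iteratedFDerivWithin_mul_le (hf ε) (hg ε) Ω.isOpen.uniqueDiffOn hxΩ
    (n := i) (by exact_mod_cast le_top)
  simp only [e] at key
  have e' : (f * g) ε = fun y => f ε y * g ε y := rfl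
  rw [e']
  refine key.trans ?_
  calc _ ≤ ∑ j ∈ Finset.range (i + 1),
        (i.choose j : ℝ) * ((c / 2 ^ l * (ε : ℝ) ^ r) * (1 * (ε : ℝ) ^ s)) := by
        refine Finset.sum_le_sum fun j hj => ?_
        have hj' : j ≤ i := Nat.lt_succ_iff.mp (Finset.mem_range.mp hj)
        have h1 := H ε (hε.trans_le (min_le_left _ _)) j (hj'.trans hi) x hx
        have h2 := H' ε (hε.trans_le (min_le_right _ _)) (i - j) ((Nat.sub_le _ _).trans hi) x hx
        rw [mul_assoc]
        refine mul_le_mul_of_nonneg_left ?_ (by positivity)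
        exact mul_le_mul h1 h2 (norm_nonneg _) (by positivity)
    _ = 2 ^ i * ((c / 2 ^ l * (ε : ℝ) ^ r) * (1 * (ε : ℝ) ^ s)) := by
        rw [← Finset.sum_mul]
        congr 1
        exact_mod_cast Nat.sum_range_choose i
    _ ≤ 2 ^ l * ((c / 2 ^ l * (ε : ℝ) ^ r) * (1 * (ε : ℝ) ^ s)) := by
        refine mul_le_mul_of_nonneg_right ?_ (by positivity)
        exact pow_le_pow_right₀ one_le_two hi
    _ = c * (ε : ℝ) ^ (r + s) := by
        rw [zpow_add₀ h0.ne']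
        field_simp

theorem IsModerate.add (hf : IsModerate Ω f) (hg : IsModerate Ω g) : IsModerate Ω (f + g) := by
  refine ⟨fun ε => (hf.1 ε).add (hg.1 ε), fun l K hK hKΩ => ?_⟩
  obtain ⟨q, hq⟩ := hf.2 l K hK hKΩ
  obtain ⟨q', hq'⟩ := hg.2 l K hK hKΩ
  exact ⟨max q q', (hq.mono (by simp)).add hKΩ hf.1 hg.1 (hq'.mono (by simp))⟩

theorem IsModerate.mul (hf : IsModerate Ω f) (hg : IsModerate Ω g) : IsModerate Ω (f * g) := by
  refine ⟨fun ε => (hf.1 ε).mul (hg.1 ε), fun l K hK hKΩ => ?_⟩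
  obtain ⟨q, hq⟩ := hf.2 l K hK hKΩ
  obtain ⟨q', hq'⟩ := hg.2 l K hK hKΩ
  exact ⟨q + q', (hq.mul hKΩ hf.1 hg.1 hq').mono (by push_cast; linarith)⟩

theorem IsModerate.const (z : ℂ) : IsModerate Ω (fun _ _ => z) := by
  refine ⟨fun ε => contDiffOn_const, fun l K _ _ => ⟨1, fun c hc => ?_⟩⟩
  refine ⟨c / (‖z‖ + 1), by positivity, fun ε hε i _ x _ => ?_⟩
  have h0 : (0 : ℝ) < ε := ε.2.1
  have h1 : ‖iteratedFDeriv ℝ i (fun _ : Space d => z) x‖ ≤ ‖z‖ := by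
    rcases Nat.eq_zero_or_pos i with rfl | hi
    · simp
    · rw [iteratedFDeriv_const_of_ne hi.ne']
      simp
  refine h1.trans ?_
  rw [lt_div_iff₀ (by positivity)] at hε
  have : c * (ε : ℝ) ^ (-((1 : ℕ) : ℤ)) = c / ε := by simp [div_eq_mul_inv]
  rw [this, le_div_iff₀ h0]
  nlinarith [norm_nonneg z]

theorem IsNegligible.add (hf : IsNegligible Ω f) (hg : IsNegligible Ω g) :
    IsNegligible Ω (f + g) :=
  ⟨fun ε => (hf.1 ε).add (hg.1 ε), fun l K hK hKΩ p =>
    (hf.2 l K hK hKΩ p).add hKΩ hf.1 hg.1 (hg.2 l K hK hKΩ p)⟩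

theorem IsNegligible.mul (hf : IsModerate Ω f) (hg : IsNegligible Ω g) :
    IsNegligible Ω (f * g) := by
  refine ⟨fun ε => (hf.1 ε).mul (hg.1 ε), fun l K hK hKΩ p => ?_⟩
  obtain ⟨q, hq⟩ := hf.2 l K hK hKΩ
  exact (hq.mul hKΩ hf.1 hg.1 (hg.2 l K hK hKΩ (q + p))).mono (by push_cast; linarith)

theorem IsNegligible.zero : IsNegligible Ω (0 : Net d) := by
  refine ⟨fun ε => contDiffOn_const, fun l K _ _ p c hc => ⟨1, one_pos, fun ε _ i _ x _ => ?_⟩⟩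
  have h0 : (0 : ℝ) < ε := ε.2.1
  have : iteratedFDeriv ℝ i ((0 : Net d) ε) x = 0 := by
    have := iteratedFDeriv_fun_zero (𝕜 := ℝ) (E := Space d) (F := ℂ) (n := i)
    exact congrFun this x
  rw [this, norm_zero]
  positivity

theorem IsModerate.restrict (h : Ω' ≤ Ω) (hf : IsModerate Ω f) : IsModerate Ω' f :=
  ⟨fun ε => (hf.1 ε).mono h, fun l K hK hKΩ => hf.2 l K hK (hKΩ.trans h)⟩

theorem IsNegligible.restrict (h : Ω' ≤ Ω) (hf : IsNegligible Ω f) : IsNegligible Ω' f :=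
  ⟨fun ε => (hf.1 ε).mono h, fun l K hK hKΩ => hf.2 l K hK (hKΩ.trans h)⟩

end Algebra

/-- The algebra of moderate nets on `Ω`. -/
def moderate {d : ℕ} (Ω : Opens (Space d)) : Subalgebra ℂ (Net d) where
  carrier := {f | IsModerate Ω f}
  mul_mem' := IsModerate.mul
  add_mem' := IsModerate.add
  algebraMap_mem' := IsModerate.const

/-- The ideal of negligible nets in the algebra of moderate nets on `Ω`. -/
def negligible {d : ℕ} (Ω : Opens (Space d)) : Ideal (moderate Ω) where
  carrier := {f | IsNegligible Ω (f : Net d)}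
  add_mem' := IsNegligible.add
  zero_mem' := IsNegligible.zero
  smul_mem' := fun f _ hg => IsNegligible.mul f.2 hg

/-- The simplified Colombeau algebra `𝒢(Ω)`. -/
def ColombeauAlgebra {d : ℕ} (Ω : Opens (Space d)) : Type := moderate Ω ⧸ negligible Ω

noncomputable instance {d : ℕ} (Ω : Opens (Space d)) : CommRing (ColombeauAlgebra Ω) :=
  inferInstanceAs (CommRing (moderate Ω ⧸ negligible Ω))

noncomputable instance {d : ℕ} (Ω : Opens (Space d)) : Algebra ℂ (ColombeauAlgebra Ω) :=
  inferInstanceAs (Algebra ℂ (moderate Ω ⧸ negligible Ω))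

/-- The class in `𝒢(Ω)` of a moderate net. -/
def cls {d : ℕ} {Ω : Opens (Space d)} (f : Net d) (hf : f ∈ moderate Ω) : ColombeauAlgebra Ω :=
  Ideal.Quotient.mk (negligible Ω) ⟨f, hf⟩

/-- The restriction map `𝒢(Ω) → 𝒢(Ω')` for `Ω' ⊆ Ω`, `[(f_ε)] ↦ [(f_ε|_{Ω'})]`. -/
noncomputable def restriction {d : ℕ} {Ω Ω' : Opens (Space d)} (h : Ω' ≤ Ω) :
    ColombeauAlgebra Ω →ₐ[ℂ] ColombeauAlgebra Ω' :=
  Ideal.quotientMapₐ (negligible Ω')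
    (Subalgebra.inclusion (fun _ hf => IsModerate.restrict h hf : moderate Ω ≤ moderate Ω'))
    (fun _ hf => IsNegligible.restrict h hf)

theorem restriction_cls {d : ℕ} {Ω Ω' : Opens (Space d)} (h : Ω' ≤ Ω) (f : Net d)
    (hf : f ∈ moderate Ω) :
    restriction h (cls f hf) = cls f (IsModerate.restrict h hf) := rfl

/-- `g` is a smooth function with compact support contained in `Ω`. -/
def IsTest {d : ℕ} {F : Type*} [NormedAddCommGroup F] [NormedSpace ℝ F]
    (Ω : Opens (Space d)) (g : Space d → F) : Prop :=
  ContDiff ℝ ∞ g ∧ HasCompactSupport g ∧ tsupport g ⊆ Ω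

open Classical in
/-- `⟨T, g⟩` for a real-valued test function `g` on `Ω` (and `0` if `g` is not one). -/
noncomputable def pairingReal {d : ℕ} {Ω : Opens (Space d)} (T : Distribution Ω ℂ ⊤)
    (g : Space d → ℝ) : ℂ :=
  if h : IsTest Ω g then T ⟨g, h.1, h.2.1, h.2.2⟩ else 0

/-- `⟨T, g⟩` for a complex-valued test function `g` on `Ω`. A complex distribution is in Mathlib an
`ℝ`-linear map from real-valued test functions to `ℂ`; here it is extended `ℂ`-linearly. -/
noncomputable def pairing {d : ℕ} {Ω : Opens (Space d)} (T : Distribution Ω ℂ ⊤)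
    (g : Space d → ℂ) : ℂ :=
  pairingReal T (fun x => (g x).re) + Complex.I * pairingReal T (fun x => (g x).im)

/-- `ρ ∈ 𝒮(ℝ^d)` is even, has integral `1`, and all its moments of positive order vanish. -/
structure IsMollifier {d : ℕ} (ρ : SchwartzMap (Space d) ℂ) : Prop where
  even : ∀ x, ρ (-x) = ρ x
  integral_eq_one : ∫ x, ρ x = 1
  moment_eq_zero : ∀ m : Fin d → ℕ, m ≠ 0 → ∫ x, ((∏ i, x i ^ m i : ℝ) : ℂ) * ρ x = 0

/-- `χ ∈ 𝒟(ℝ^d)`, `0 ≤ χ ≤ 1`, `χ = 1` on the closed unit ball, `χ = 0` off the open ball of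
radius `2`. -/
structure IsCutoff {d : ℕ} (χ : Space d → ℝ) : Prop where
  isTest : IsTest ⊤ χ
  mem_Icc : ∀ x, χ x ∈ Icc (0 : ℝ) 1
  eq_one : ∀ x ∈ Metric.closedBall (0 : Space d) 1, χ x = 1
  eq_zero : ∀ x ∉ Metric.ball (0 : Space d) 2, χ x = 0

/-- `ρ_ε(x) = ε^{-d} ρ(x / ε)`. -/
noncomputable def rhoNet {d : ℕ} (ρ : SchwartzMap (Space d) ℂ) : Net d :=
  fun ε x => ((1 / (ε : ℝ) ^ d : ℝ) : ℂ) * ρ ((ε : ℝ)⁻¹ • x)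

open Classical in
/-- `θ_ε(x) = ρ_ε(x) χ(|ln ε| x)` for `ε ∈ (0, 1)`, and `θ_1 = 1`. -/
noncomputable def thetaNet {d : ℕ} (ρ : SchwartzMap (Space d) ℂ) (χ : Space d → ℝ) : Net d :=
  fun ε x => if (ε : ℝ) = 1 then 1 else rhoNet ρ ε x * (χ (|Real.log ε| • x) : ℂ)

/-- `K_ε = {x ∈ Ω | d(x, ℝ^d \ Ω) ≥ ε, d(x, 0) ≤ 1 / ε}`; the distance to the empty set is `∞`. -/
def exhaustion {d : ℕ} (Ω : Opens (Space d)) (ε : Eps) : Set (Space d) :=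
  {x | x ∈ Ω ∧ ENNReal.ofReal ε ≤ Metric.infEDist x (Ω : Set (Space d))ᶜ ∧ dist x 0 ≤ 1 / (ε : ℝ)}

/-- Cutoffs `κ_ε ∈ 𝒟(Ω)`, `0 ≤ κ_ε ≤ 1`, `κ_ε = 1` on `K_ε`. -/
structure IsCutoffNet {d : ℕ} (Ω : Opens (Space d)) (κ : Eps → Space d → ℝ) : Prop where
  isTest : ∀ ε, IsTest Ω (κ ε)
  mem_Icc : ∀ ε x, κ ε x ∈ Icc (0 : ℝ) 1
  eq_one : ∀ ε, ∀ x ∈ exhaustion Ω ε, κ ε x = 1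

/-- A locally finite open covering `(U_λ)` of `Ω` such that the closure of each `U_λ` is a compact
subset of `Ω`. -/
structure IsCovering {d : ℕ} (Ω : Opens (Space d)) {L : Type*} (U : L → Opens (Space d)) :
    Prop where
  isCompact_closure : ∀ l, IsCompact (closure (U l : Set (Space d)))
  closure_subset : ∀ l, closure (U l : Set (Space d)) ⊆ Ω
  covers : ∀ x ∈ Ω, ∃ l, x ∈ U l
  locallyFinite : ∀ x ∈ Ω, ∃ W ∈ 𝓝 x, {l | ((U l : Set (Space d)) ∩ W).Nonempty}.Finite

theorem IsCovering.le {d : ℕ} {Ω : Opens (Space d)} {L : Type*} {U : L → Opens (Space d)}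
    (h : IsCovering Ω U) (l : L) : U l ≤ Ω := subset_closure.trans (h.closure_subset l)

/-- `ψ_λ ∈ 𝒟(Ω)`, `0 ≤ ψ_λ ≤ 1`, `ψ_λ = 1` on a neighbourhood of the closure of `U_λ`. -/
structure IsPlateau {d : ℕ} (Ω : Opens (Space d)) {L : Type*} (U : L → Opens (Space d))
    (ψ : L → Space d → ℝ) : Prop where
  isTest : ∀ l, IsTest Ω (ψ l)
  mem_Icc : ∀ l x, ψ l x ∈ Icc (0 : ℝ) 1
  eq_one : ∀ l, ∀ᶠ x in 𝓝ˢ (closure (U l : Set (Space d))), ψ l x = 1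

/-- Numbers `e_λ ∈ (0, 1]` such that for all `ε ∈ (0, e_λ ^ 2]` and `y ∈ U_λ` the function
`x ↦ θ_ε(y - x)` belongs to `𝒟(Ω)`. -/
def IsThreshold {d : ℕ} (Ω : Opens (Space d)) (θ : Net d) {L : Type*} (U : L → Opens (Space d))
    (e : L → Eps) : Prop :=
  ∀ l, ∀ ε : Eps, (ε : ℝ) ≤ (e l : ℝ) ^ 2 → ∀ y ∈ U l, IsTest Ω (fun x => θ ε (y - x))

/-- The net `(aT) * g_ε` for a cutoff `a ∈ 𝒟(Ω)`, a distribution `T` on `Ω` and smooth `g_ε`: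
`((aT) * g_ε)(y) = ⟨aT, g_ε(y - ·)⟩ = ⟨T, a g_ε(y - ·)⟩`. The cutoff may depend on `ε`. -/
noncomputable def cutConv {d : ℕ} {Ω : Opens (Space d)} (a : Eps → Space d → ℝ) (g : Net d)
    (T : Distribution Ω ℂ ⊤) : Net d :=
  fun ε y => pairing T (fun x => (a ε x : ℂ) * g ε (y - x))

/-- The square of an element of `(0, 1]`. -/
def Eps.sq (e : Eps) : Eps := ⟨(e : ℝ) ^ 2, pow_pos e.2.1 2, pow_le_one₀ e.2.1.le e.2.2⟩

/-- `T_ε(y) = ⟨T, θ_ε(y - ·)⟩` for `ε ≤ e ^ 2`, and `T_ε = T_{e ^ 2}` for `ε > e ^ 2`. -/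
noncomputable def localNet {d : ℕ} {Ω : Opens (Space d)} (θ : Net d) (e : Eps)
    (T : Distribution Ω ℂ ⊤) : Net d :=
  fun ε y => pairing T (fun x => θ (min ε e.sq) (y - x))

/-- `u : 𝒟'(Ω) → 𝒢(Ω)` is the map `T ↦ [(N(T)_ε)]`. -/
def IsGivenBy {d : ℕ} {Ω : Opens (Space d)} (N : Distribution Ω ℂ ⊤ → Net d)
    (u : Distribution Ω ℂ ⊤ → ColombeauAlgebra Ω) : Prop :=
  ∀ T, ∃ h : N T ∈ moderate Ω, u T = cls (N T) h

/-- `u : 𝒟'(Ω) → 𝒢(Ω)` is glued from the maps `T ↦ [(N_λ(T)_ε)] ∈ 𝒢(U_λ)`, that is,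
`u(T)|_{U_λ} = [(N_λ(T)_ε)]` in `𝒢(U_λ)` for all `λ` and `T`. -/
def IsGluedFrom {d : ℕ} {Ω : Opens (Space d)} {L : Type*} {U : L → Opens (Space d)}
    (hU : IsCovering Ω U) (N : L → Distribution Ω ℂ ⊤ → Net d)
    (u : Distribution Ω ℂ ⊤ → ColombeauAlgebra Ω) : Prop :=
  ∀ l T, ∃ h : N l T ∈ moderate (U l), restriction (hU.le l) (u T) = cls (N l T) h

/-- `u` is the map `ι_A` : it is glued from the maps `T ↦ [((ψ_λ T) * ρ_ε)|_{U_λ}]`. -/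
def IsIotaA {d : ℕ} {Ω : Opens (Space d)} (ρ : SchwartzMap (Space d) ℂ) {L : Type*}
    {U : L → Opens (Space d)} (hU : IsCovering Ω U) (ψ : L → Space d → ℝ)
    (u : Distribution Ω ℂ ⊤ → ColombeauAlgebra Ω) : Prop :=
  IsGluedFrom hU (fun l => cutConv (fun _ => ψ l) (rhoNet ρ)) u

/-- `u` is the map `ι_S` : `T ↦ [((κ_ε T) * θ_ε)]`. -/
def IsIotaS {d : ℕ} {Ω : Opens (Space d)} (ρ : SchwartzMap (Space d) ℂ) (χ : Space d → ℝ)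
    (κ : Eps → Space d → ℝ) (u : Distribution Ω ℂ ⊤ → ColombeauAlgebra Ω) : Prop :=
  IsGivenBy (cutConv κ (thetaNet ρ χ)) u

/-- `u` is the map `ι'_S` : it is glued from the maps `T ↦ [(⟨T, θ_ε(y - ·)⟩)_ε]`, `y ∈ V_λ`. -/
def IsIotaS' {d : ℕ} {Ω : Opens (Space d)} (ρ : SchwartzMap (Space d) ℂ) (χ : Space d → ℝ)
    {L : Type*} {V : L → Opens (Space d)} (hV : IsCovering Ω V) (e : L → Eps)
    (u : Distribution Ω ℂ ⊤ → ColombeauAlgebra Ω) : Prop :=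
  IsGluedFrom hV (fun l => localNet (thetaNet ρ χ) (e l)) u

end Colombeau

/-!
A distribution acts on functions supported in a compact set as a distribution of finite order, so
for a test function `a` convolution with `aT` turns a bound on all derivatives of `g_ε`, uniform on
`ℝ^d`, into a bound of the same order in `ε` on all derivatives of `(aT) * g_ε`. Because `ρ` is a
Schwartz function, `ρ_ε` and all its derivatives are `O(ε ^ p)` for every `p` where
`|x| |ln ε| ≥ 1`, so that `θ_ε - ρ_ε` is negligible uniformly on `ℝ^d`; hence `ρ_ε` may be replaced
by `θ_ε` in `ι_A`. The supports of the `θ_ε` shrink to `0`, so that near a given compact set and for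
small `ε` none of the cutoffs `ψ_λ`, `κ_ε` is seen by the convolution with `θ_ε`: all three nets
are there equal to `⟨T, θ_ε(y - ·)⟩`.
-/

namespace Colombeau

open Filter

section Calculus

variable {𝕜 E F : Type*} [NontriviallyNormedField 𝕜]
  [NormedAddCommGroup E] [NormedSpace 𝕜 E] [NormedAddCommGroup F] [NormedSpace 𝕜 F]

theorem norm_iteratedFDeriv_mul_le_two_pow_mul {A : Type*} [NormedRing A] [NormedAlgebra 𝕜 A]
    {f g : E → A} {n : ℕ} (hf : ContDiff 𝕜 n f) (hg : ContDiff 𝕜 n g) {x : E} {B : ℝ}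
    (h : ∀ j ≤ n, ‖iteratedFDeriv 𝕜 j f x‖ * ‖iteratedFDeriv 𝕜 (n - j) g x‖ ≤ B) :
    ‖iteratedFDeriv 𝕜 n (fun y => f y * g y) x‖ ≤ 2 ^ n * B :=
  calc
    _ ≤ ∑ j ∈ Finset.range (n + 1), (n.choose j : ℝ) * ‖iteratedFDeriv 𝕜 j f x‖ *
        ‖iteratedFDeriv 𝕜 (n - j) g x‖ := norm_iteratedFDeriv_mul_le hf hg x le_rfl
    _ ≤ ∑ j ∈ Finset.range (n + 1), (n.choose j : ℝ) * B := by
      refine Finset.sum_le_sum fun j hj => ?_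
      rw [mul_assoc]
      exact mul_le_mul_of_nonneg_left (h j (Finset.mem_range_succ_iff.1 hj)) (Nat.cast_nonneg _)
    _ = 2 ^ n * B := by
      rw [← Finset.sum_mul]
      exact_mod_cast congrArg (· * B) (congrArg Nat.cast (Nat.sum_range_choose n))

theorem norm_iteratedFDeriv_const_le (c : F) (n : ℕ) (x : E) :
    ‖iteratedFDeriv 𝕜 n (fun _ : E => c) x‖ ≤ ‖c‖ := by
  cases n with
  | zero => exact norm_iteratedFDeriv_zero.le
  | succ n => simp [iteratedFDeriv_const_of_ne n.succ_ne_zero]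

theorem norm_iteratedFDeriv_comp_const_sub (g : E → F) (n : ℕ) (y x : E) :
    ‖iteratedFDeriv 𝕜 n (fun x => g (y - x)) x‖ = ‖iteratedFDeriv 𝕜 n g (y - x)‖ := by
  have h := (LinearIsometryEquiv.neg 𝕜 (E := E)).norm_iteratedFDeriv_comp_right
    (fun z => g (y + z)) x n
  rw [iteratedFDeriv_comp_add_left] at h
  simpa [Function.comp_def, sub_eq_add_neg] using h

theorem norm_iteratedFDeriv_succ_le_of_forall_apply {f : E → F} {n : ℕ} {x : E} {C : ℝ}
    (hf : ContDiff 𝕜 (n + 1) f) (hC : 0 ≤ C)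
    (h : ∀ v, ‖iteratedFDeriv 𝕜 n (fun y => fderiv 𝕜 f y v) x‖ ≤ C * ‖v‖) :
    ‖iteratedFDeriv 𝕜 (n + 1) f x‖ ≤ C := by
  refine ContinuousMultilinearMap.opNorm_le_bound hC fun v => ?_
  have hderiv : iteratedFDeriv 𝕜 (n + 1) f x v
      = iteratedFDeriv 𝕜 n (fun y => fderiv 𝕜 f y (v (Fin.last n))) x (Fin.init v) := by
    rw [iteratedFDeriv_succ_apply_right]
    have hcomp := (ContinuousLinearMap.apply 𝕜 F (v (Fin.last n))).iteratedFDeriv_comp_left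
      (x := x) (hf.fderiv_right le_rfl).contDiffAt (le_refl (n : ℕ∞ω))
    exact (congrArg (· (Fin.init v)) hcomp).symm
  calc
    _ ≤ C * ‖v (Fin.last n)‖ * ∏ i, ‖Fin.init v i‖ := by
      rw [hderiv]
      exact (ContinuousMultilinearMap.le_opNorm _ _).trans
        (mul_le_mul_of_nonneg_right (h _) (Finset.prod_nonneg fun _ _ => norm_nonneg _))
    _ = C * ∏ i, ‖v i‖ := by
      rw [Fin.prod_univ_castSucc, mul_assoc, mul_comm ‖v (Fin.last n)‖]
      rfl

theorem exists_forall_norm_iteratedFDeriv_le {f : E → F} {n : ℕ} (hf : ContDiff 𝕜 n f)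
    {K : Set E} (hK : IsCompact K) :
    ∃ C, 0 ≤ C ∧ ∀ i ≤ n, ∀ x ∈ K, ‖iteratedFDeriv 𝕜 i f x‖ ≤ C := by
  have hbound : ∀ i ≤ n, ∃ C, ∀ x ∈ K, ‖iteratedFDeriv 𝕜 i f x‖ ≤ C := fun i hi =>
    hK.exists_bound_of_continuousOn
      (hf.continuous_iteratedFDeriv (by exact_mod_cast hi)).continuousOn
  choose! C hC using hbound
  refine ⟨∑ i ∈ Finset.range (n + 1), |C i|, by positivity, fun i hi x hx => ?_⟩
  exact (hC i hi x hx).trans ((le_abs_self _).trans (Finset.single_le_sum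
    (f := fun i => |C i|) (fun _ _ => abs_nonneg _) (Finset.mem_range_succ_iff.2 hi)))

end Calculus

section TaylorRemainder

/-- The remainder `g(z + h) - g(z) - g'(z) h` of the first order Taylor expansion of `g`, as a
function of the base point `z`. -/
noncomputable def taylorRemainder {E F : Type*} [NormedAddCommGroup E] [NormedSpace ℝ E]
    [NormedAddCommGroup F] [NormedSpace ℝ F] (g : E → F) (h z : E) : F :=
  g (z + h) - g z - fderiv ℝ g z h

variable {E F : Type*} [NormedAddCommGroup E] [NormedSpace ℝ E]
  [NormedAddCommGroup F] [NormedSpace ℝ F] {g : E → F} {K : Set E} {c : ℝ}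

theorem contDiff_taylorRemainder {n : ℕ∞ω} (hg : ContDiff ℝ (n + 1) g) (h : E) :
    ContDiff ℝ n (taylorRemainder g h) :=
  have hgn : ContDiff ℝ n g := hg.of_le le_self_add
  ((hgn.comp (contDiff_id.add contDiff_const)).sub hgn).sub
    ((hg.fderiv_right le_rfl).clm_apply contDiff_const)

theorem eventually_norm_taylorRemainder_le (hg : ContDiff ℝ 1 g) (hK : IsCompact K) (hc : 0 < c) :
    ∀ᶠ h in 𝓝 (0 : E), ∀ z ∈ K, ‖taylorRemainder g h z‖ ≤ c * ‖h‖ := by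
  have hcont : Continuous (fderiv ℝ g) := hg.continuous_fderiv one_ne_zero
  obtain ⟨δ, hδ, hclose⟩ := Metric.mem_uniformity_dist.1
    (hK.uniformContinuousAt_of_continuousAt (fderiv ℝ g) (fun x _ => hcont.continuousAt)
      (Metric.dist_mem_uniformity hc))
  filter_upwards [Metric.ball_mem_nhds 0 hδ] with h hh z hz
  rw [mem_ball_zero_iff] at hh
  have hmvt := (convex_closedBall z ‖h‖).norm_image_sub_le_of_norm_fderiv_le' (𝕜 := ℝ)
    (φ := fderiv ℝ g z) (C := c) (y := z + h)
    (fun x _ => hg.differentiable one_ne_zero x) (fun x hx => ?_)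
    (Metric.mem_closedBall_self (norm_nonneg h)) (by simp)
  · simpa [taylorRemainder] using hmvt
  · rw [← dist_eq_norm, dist_comm]
    exact (hclose (Metric.mem_closedBall'.1 hx |>.trans_lt hh) hz).le

theorem fderiv_taylorRemainder (hg : ContDiff ℝ 2 g) (h : E) :
    fderiv ℝ (taylorRemainder g h) = taylorRemainder (fderiv ℝ g) h := by
  funext z
  have hdiff : Differentiable ℝ g := hg.differentiable two_ne_zero
  have hdiff' : Differentiable ℝ (fderiv ℝ g) :=
    (hg.fderiv_right (m := 1) (by norm_num)).differentiable one_ne_zero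
  have hsymm : IsSymmSndFDerivAt ℝ g z := hg.contDiffAt.isSymmSndFDerivAt (by simp)
  have hderiv := (((hasFDerivAt_comp_add_right h).2 (hdiff (z + h)).hasFDerivAt).fun_sub
    (hdiff z).hasFDerivAt).fun_sub ((hdiff' z).hasFDerivAt.clm_apply (hasFDerivAt_const h z))
  refine hderiv.fderiv.trans ?_
  ext v
  simpa [taylorRemainder] using hsymm v h

-- `E` and `F` lie in one universe because the induction replaces `F` by `E →L[ℝ] F`.
theorem eventually_norm_iteratedFDeriv_taylorRemainder_le.{u} {E F : Type u}
    [NormedAddCommGroup E] [NormedSpace ℝ E] [NormedAddCommGroup F] [NormedSpace ℝ F] {g : E → F}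
    {K : Set E} (j : ℕ) (hg : ContDiff ℝ (j + 1) g) (hK : IsCompact K) (hc : 0 < c) :
    ∀ᶠ h in 𝓝 (0 : E), ∀ z ∈ K, ‖iteratedFDeriv ℝ j (taylorRemainder g h) z‖ ≤ c * ‖h‖ := by
  induction j generalizing F with
  | zero =>
    simp only [norm_iteratedFDeriv_zero]
    exact eventually_norm_taylorRemainder_le (by simpa using hg) hK hc
  | succ j ih =>
    have hg' : ContDiff ℝ (j + 1) (fderiv ℝ g) := hg.fderiv_right (by push_cast; rfl)
    have hg2 : ContDiff ℝ 2 g := hg.of_le (by norm_cast; omega)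
    simp only [← norm_iteratedFDeriv_fderiv, fderiv_taylorRemainder hg2]
    exact ih hg'

end TaylorRemainder

section SmallParameter

theorem tendsto_coe_eps_atBot : Tendsto ((↑) : Eps → ℝ) atBot (𝓝[>] 0) := by
  rw [← comap_coe_nhdsGT_of_Ioo_subset (a := 0) (s := Ioc (0 : ℝ) 1) (fun _ hx => hx.1)
    fun _ => ⟨1, one_pos, Ioo_subset_Ioc_self⟩]
  exact tendsto_comap

theorem eventually_eps_lt {η : ℝ} (hη : 0 < η) : ∀ᶠ ε : Eps in atBot, (ε : ℝ) < η :=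
  tendsto_coe_eps_atBot.eventually (eventually_nhdsWithin_of_eventually_nhds (gt_mem_nhds hη))

theorem eventually_eps_atBot_iff {p : Eps → Prop} :
    (∀ᶠ ε in atBot, p ε) ↔ ∃ η : ℝ, 0 < η ∧ ∀ ε : Eps, (ε : ℝ) < η → p ε := by
  constructor
  · intro h
    obtain ⟨η, hη⟩ := eventually_atBot.1 h
    exact ⟨η, η.2.1, fun ε hε => hη ε hε.le⟩
  · rintro ⟨η, hη, h⟩
    exact (eventually_eps_lt hη).mono h

end SmallParameter

section SeminormLittleO

variable {d : ℕ} {K K' : Set (Space d)} {l : ℕ} {r : ℤ} {f g : Net d}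

theorem seminormLittleO_iff_eventually :
    SeminormLittleO K l f r ↔ ∀ c : ℝ, 0 < c → ∀ᶠ ε : Eps in atBot, ∀ i ≤ l, ∀ x ∈ K,
      ‖iteratedFDeriv ℝ i (f ε) x‖ ≤ c * (ε : ℝ) ^ r :=
  forall₂_congr fun _ _ => eventually_eps_atBot_iff.symm

theorem SeminormLittleO.mono_set (hK : K ⊆ K') (h : SeminormLittleO K' l f r) :
    SeminormLittleO K l f r := by
  rw [seminormLittleO_iff_eventually] at h ⊢
  exact fun c hc => (h c hc).mono fun ε hε i hi x hx => hε i hi x (hK hx)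

theorem SeminormLittleO.union (h : SeminormLittleO K l f r) (h' : SeminormLittleO K' l f r) :
    SeminormLittleO (K ∪ K') l f r := by
  rw [seminormLittleO_iff_eventually] at h h' ⊢
  intro c hc
  filter_upwards [h c hc, h' c hc] with ε hε hε' i hi x hx
  exact hx.elim (hε i hi x) (hε' i hi x)

theorem SeminormLittleO.congr (h : ∀ᶠ ε in atBot, f ε =ᶠ[𝓝ˢ K] g ε)
    (hf : SeminormLittleO K l f r) : SeminormLittleO K l g r := by
  rw [seminormLittleO_iff_eventually] at hf ⊢
  intro c hc
  filter_upwards [h, hf c hc] with ε hfg hε i hi x hx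
  have hfgx : f ε =ᶠ[𝓝 x] g ε := hfg.filter_mono (nhds_le_nhdsSet hx)
  exact (hfgx.iteratedFDeriv ℝ i).eq_of_nhds ▸ hε i hi x hx

theorem SeminormLittleO.of_locally (hK : IsCompact K)
    (h : ∀ x ∈ K, ∃ N ∈ 𝓝[K] x, SeminormLittleO N l f r) : SeminormLittleO K l f r :=
  hK.induction_on (fun _ _ => ⟨1, one_pos, fun _ _ _ _ _ hx => hx.elim⟩)
    (fun _ _ hst ht => ht.mono_set hst) (fun _ _ hs ht => hs.union ht) h

theorem SeminormLittleO.of_forall_exists_le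
    (h : ∀ i ≤ l, ∃ C : ℝ, ∀ᶠ ε : Eps in atBot, ∀ x ∈ K,
      ‖iteratedFDeriv ℝ i (f ε) x‖ ≤ C * (ε : ℝ) ^ (r + 1)) : SeminormLittleO K l f r := by
  rw [seminormLittleO_iff_eventually]
  intro c hc
  suffices H : ∀ i ∈ Iic l, ∀ᶠ ε : Eps in atBot, ∀ x ∈ K,
      ‖iteratedFDeriv ℝ i (f ε) x‖ ≤ c * (ε : ℝ) ^ r from
    ((finite_Iic l).eventually_all.2 H)
  intro i hi
  obtain ⟨C, hC⟩ := h i hi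
  have hsmall : 0 < c / (|C| + 1) := by positivity
  filter_upwards [hC, eventually_eps_lt hsmall] with ε hε hεc x hx
  have hε0 : (0 : ℝ) < ε := ε.2.1
  have hCε : C * ε ≤ c := by
    rw [lt_div_iff₀ (by positivity)] at hεc
    nlinarith [le_abs_self C]
  calc
    _ ≤ C * (ε : ℝ) ^ (r + 1) := hε x hx
    _ = C * ε * (ε : ℝ) ^ r := by rw [zpow_add_one₀ hε0.ne', mul_assoc, mul_comm (ε : ℝ)]
    _ ≤ c * (ε : ℝ) ^ r := mul_le_mul_of_nonneg_right hCε (by positivity)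

end SeminormLittleO

section TestFunctions

variable {d : ℕ} {Ω : Opens (Space d)} {F G : Type*} [NormedAddCommGroup F] [NormedSpace ℝ F]
  [NormedAddCommGroup G] [NormedSpace ℝ G]

theorem IsTest.clm_comp (L : F →L[ℝ] G) {g : Space d → F} (h : IsTest Ω g) :
    IsTest Ω (fun x => L (g x)) :=
  ⟨L.contDiff.comp h.1, h.2.1.comp_left L.map_zero,
    (tsupport_comp_subset L.map_zero g).trans h.2.2⟩

theorem IsTest.add {f g : Space d → F} (hf : IsTest Ω f) (hg : IsTest Ω g) :
    IsTest Ω (fun x => f x + g x) :=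
  ⟨hf.1.add hg.1, hf.2.1.add hg.2.1, (tsupport_add f g).trans (union_subset hf.2.2 hg.2.2)⟩

theorem IsTest.const_smul (c : ℝ) {f : Space d → F} (hf : IsTest Ω f) :
    IsTest Ω (fun x => c • f x) :=
  hf.clm_comp (c • ContinuousLinearMap.id ℝ F)

theorem exists_isTest_eventually_eq_one {K : Set (Space d)} (hK : IsCompact K) (hKΩ : K ⊆ Ω) :
    ∃ a : Space d → ℝ, IsTest Ω a ∧ ∀ᶠ x in 𝓝ˢ K, a x = 1 := by
  obtain ⟨L, hL, hKL, hLΩ⟩ := exists_compact_between hK Ω.isOpen hKΩ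
  obtain ⟨a, ha_one, ha_zero, -⟩ := exists_contMDiffMap_one_nhds_of_subset_interior
    (n := (⊤ : ℕ∞)) (modelWithCornersSelf ℝ (Space d)) hK.isClosed hKL
  have hsupp : tsupport a ⊆ L := closure_minimal
    (fun x hx => not_imp_comm.1 (ha_zero x) hx) hL.isClosed
  exact ⟨a, ⟨a.contMDiff.contDiff, hL.of_isClosed_subset (isClosed_tsupport _) hsupp,
    hsupp.trans hLΩ⟩, ha_one⟩

end TestFunctions

section Pairing

variable {d : ℕ} {Ω : Opens (Space d)} {K : Set (Space d)} (S T : Distribution Ω ℂ ⊤)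

theorem pairingReal_of_isTest {g : Space d → ℝ} (h : IsTest Ω g) :
    pairingReal T g = T ⟨g, h.1, h.2.1, h.2.2⟩ := dif_pos h

theorem pairingReal_add {f g : Space d → ℝ} (hf : IsTest Ω f) (hg : IsTest Ω g) :
    pairingReal T (fun x => f x + g x) = pairingReal T f + pairingReal T g := by
  rw [pairingReal_of_isTest T hf, pairingReal_of_isTest T hg,
    pairingReal_of_isTest T (hf.add hg), ← map_add]
  rfl

theorem pairingReal_smul (c : ℝ) {f : Space d → ℝ} (hf : IsTest Ω f) :
    pairingReal T (fun x => c • f x) = c • pairingReal T f := by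
  rw [pairingReal_of_isTest T hf, pairingReal_of_isTest T (hf.const_smul c), ← map_smul]
  rfl

theorem pairing_add {f g : Space d → ℂ} (hf : IsTest Ω f) (hg : IsTest Ω g) :
    pairing T (fun x => f x + g x) = pairing T f + pairing T g := by
  have hre := pairingReal_add T (hf.clm_comp Complex.reCLM) (hg.clm_comp Complex.reCLM)
  have him := pairingReal_add T (hf.clm_comp Complex.imCLM) (hg.clm_comp Complex.imCLM)
  simp only [Complex.reCLM_apply, Complex.imCLM_apply] at hre him
  simp only [pairing, Complex.add_re, Complex.add_im, hre, him]
  ring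

theorem pairing_smul (c : ℝ) {f : Space d → ℂ} (hf : IsTest Ω f) :
    pairing T (fun x => c • f x) = c • pairing T f := by
  have hre := pairingReal_smul T c (hf.clm_comp Complex.reCLM)
  have him := pairingReal_smul T c (hf.clm_comp Complex.imCLM)
  simp only [Complex.reCLM_apply, Complex.imCLM_apply] at hre him
  simp only [pairing, Complex.smul_re, Complex.smul_im, hre, him, smul_add, mul_smul_comm]

theorem pairingReal_add_left (g : Space d → ℝ) :
    pairingReal (S + T) g = pairingReal S g + pairingReal T g := by
  unfold pairingReal
  split_ifs
  · rfl
  · exact (add_zero 0).symm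

theorem pairingReal_smul_left (c : ℂ) (g : Space d → ℝ) :
    pairingReal (c • T) g = c * pairingReal T g := by
  unfold pairingReal
  split_ifs
  · rfl
  · exact (mul_zero c).symm

theorem pairing_add_left (g : Space d → ℂ) :
    pairing (S + T) g = pairing S g + pairing T g := by
  simp only [pairing, pairingReal_add_left]
  ring

theorem pairing_smul_left (c : ℂ) (g : Space d → ℂ) :
    pairing (c • T) g = c * pairing T g := by
  simp only [pairing, pairingReal_smul_left]
  ring

theorem exists_norm_pairingReal_le (hK : IsCompact K) (hKΩ : K ⊆ Ω) :
    ∃ C : ℝ, 0 ≤ C ∧ ∃ m : ℕ, ∀ g : Space d → ℝ, IsTest Ω g → tsupport g ⊆ K →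
      ∀ B : ℝ, 0 ≤ B → (∀ i ≤ m, ∀ x ∈ K, ‖iteratedFDeriv ℝ i g x‖ ≤ B) →
        ‖pairingReal T g‖ ≤ C * B := by
  let K' : Compacts (Space d) := ⟨K, hK⟩
  have hK' : (K' : Set (Space d)) ⊆ Ω := hKΩ
  let TK : ContDiffMapSupportedIn (Space d) ℝ ⊤ K' →ₗ[ℝ] ℂ :=
    (T : TestFunction Ω ℝ ⊤ →ₗ[ℝ] ℂ).comp
      (TestFunction.ofSupportedInCLM (F := ℝ) (n := ⊤) ℝ hK').toLinearMap
  have hTK : Continuous TK :=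
    (map_continuous T).comp (TestFunction.continuous_ofSupportedIn (F := ℝ) (n := ⊤) hK')
  obtain ⟨s, C, -, hC⟩ := Seminorm.bound_of_continuous
    (ContDiffMapSupportedIn.withSeminorms ℝ (Space d) ℝ ⊤ K')
    ((normSeminorm ℝ ℂ).comp TK) (continuous_norm.comp hTK)
  refine ⟨C, C.2, s.sup id, fun g hg hgK B hB h => ?_⟩
  let gK : ContDiffMapSupportedIn (Space d) ℝ ⊤ K' :=
    ContDiffMapSupportedIn.of_support_subset hg.1 ((subset_tsupport _).trans hgK)
  have hpair : pairingReal T g = TK gK := pairingReal_of_isTest T hg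
  rw [hpair]
  refine (hC gK).trans (mul_le_mul_of_nonneg_left ?_ C.2)
  refine Seminorm.finset_sup_apply_le hB fun i hi => ?_
  exact (ContDiffMapSupportedIn.seminorm_top_le_iff ℝ hB i gK).2
    fun x hx => h i (Finset.le_sup (f := id) hi) x hx

theorem exists_norm_pairing_le (hK : IsCompact K) (hKΩ : K ⊆ Ω) :
    ∃ C : ℝ, 0 ≤ C ∧ ∃ m : ℕ, ∀ g : Space d → ℂ, IsTest Ω g → tsupport g ⊆ K →
      ∀ B : ℝ, 0 ≤ B → (∀ i ≤ m, ∀ x ∈ K, ‖iteratedFDeriv ℝ i g x‖ ≤ B) →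
        ‖pairing T g‖ ≤ C * B := by
  obtain ⟨C, hC, m, hTC⟩ := exists_norm_pairingReal_le T hK hKΩ
  refine ⟨2 * C, by positivity, m, fun g hg hgK B hB h => ?_⟩
  have hpart (L : ℂ →L[ℝ] ℝ) (hL : ‖L‖ = 1) : ‖pairingReal T (fun x => L (g x))‖ ≤ C * B := by
    refine hTC _ (hg.clm_comp L) ((tsupport_comp_subset L.map_zero g).trans hgK) B hB
      fun i hi x hx => ?_
    refine (L.norm_iteratedFDeriv_comp_left hg.1.contDiffAt (by exact_mod_cast le_top)).trans ?_
    rw [hL, one_mul]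
    exact h i hi x hx
  calc
    ‖pairing T g‖ ≤ ‖pairingReal T (fun x => (g x).re)‖ + ‖pairingReal T (fun x => (g x).im)‖ := by
      simpa [pairing] using norm_add_le (pairingReal T fun x => (g x).re)
        (Complex.I * pairingReal T fun x => (g x).im)
    _ ≤ C * B + C * B :=
      add_le_add (hpart _ Complex.reCLM_norm) (hpart _ Complex.imCLM_norm)
    _ = 2 * C * B := by ring

end Pairing

section Convolution

variable {d : ℕ} {Ω : Opens (Space d)} (T : Distribution Ω ℂ ⊤) {a : Space d → ℝ}
  {f g : Space d → ℂ}

/-- The convolution `(aT) * g` of the distribution `T`, cut off by a test function `a`, with a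
smooth function `g`, so that `cutConv a g T ε = conv T (a ε) (g ε)`. -/
noncomputable def conv (T : Distribution Ω ℂ ⊤) (a : Space d → ℝ) (g : Space d → ℂ)
    (y : Space d) : ℂ :=
  pairing T (fun x => (a x : ℂ) * g (y - x))

theorem IsTest.ofReal_mul (ha : IsTest Ω a) (hg : ContDiff ℝ ∞ g) :
    IsTest Ω (fun x => (a x : ℂ) * g x) :=
  have ha' : IsTest Ω (fun x => (a x : ℂ)) := ha.clm_comp Complex.ofRealCLM
  ⟨ha'.1.mul hg, ha'.2.1.mul_right, tsupport_mul_subset_left.trans ha'.2.2⟩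

theorem tsupport_ofReal_mul_subset : tsupport (fun x => (a x : ℂ) * g x) ⊆ tsupport a :=
  tsupport_mul_subset_left.trans (tsupport_comp_subset Complex.ofReal_zero a)

theorem contDiff_comp_const_sub {n : ℕ∞ω} (hg : ContDiff ℝ n g) (y : Space d) :
    ContDiff ℝ n (fun x => g (y - x)) :=
  hg.comp (contDiff_const.sub contDiff_id)

theorem conv_add (ha : IsTest Ω a) (hf : ContDiff ℝ ∞ f) (hg : ContDiff ℝ ∞ g) (y : Space d) :
    conv T a (fun z => f z + g z) y = conv T a f y + conv T a g y := by
  simpa only [conv, mul_add] using pairing_add T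
    (ha.ofReal_mul (contDiff_comp_const_sub hf y)) (ha.ofReal_mul (contDiff_comp_const_sub hg y))

theorem conv_smul (ha : IsTest Ω a) (hf : ContDiff ℝ ∞ f) (c : ℝ) (y : Space d) :
    conv T a (fun z => c • f z) y = c • conv T a f y := by
  simpa only [conv, mul_smul_comm] using
    pairing_smul T c (ha.ofReal_mul (contDiff_comp_const_sub hf y))

theorem conv_sub (ha : IsTest Ω a) (hf : ContDiff ℝ ∞ f) (hg : ContDiff ℝ ∞ g) (y : Space d) :
    conv T a (fun z => f z - g z) y = conv T a f y - conv T a g y := by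
  rw [eq_sub_iff_add_eq, ← conv_add T ha (hf.sub hg) hg]
  simp only [sub_add_cancel]

theorem exists_norm_conv_le (ha : IsTest Ω a) :
    ∃ C : ℝ, 0 ≤ C ∧ ∃ m : ℕ, ∀ g : Space d → ℂ, ContDiff ℝ ∞ g → ∀ y, ∀ B : ℝ, 0 ≤ B →
      (∀ i ≤ m, ∀ x ∈ tsupport a, ‖iteratedFDeriv ℝ i g (y - x)‖ ≤ B) →
        ‖conv T a g y‖ ≤ C * B := by
  obtain ⟨C, hC, m, hTC⟩ := exists_norm_pairing_le T ha.2.1 ha.2.2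
  have ha' : ContDiff ℝ ∞ (fun x => (a x : ℂ)) := Complex.ofRealCLM.contDiff.comp ha.1
  obtain ⟨A, hA, haA⟩ := exists_forall_norm_iteratedFDeriv_le (n := m) (contDiff_infty.1 ha' m)
    ha.2.1
  refine ⟨C * (2 ^ m * A), by positivity, m, fun g hg y B hB hgB => ?_⟩
  have hgy := contDiff_comp_const_sub hg y
  rw [mul_assoc]
  refine hTC _ (ha.ofReal_mul hgy) tsupport_ofReal_mul_subset _ (by positivity) fun i hi x hx => ?_
  calc
    _ ≤ 2 ^ i * (A * B) := by
      refine norm_iteratedFDeriv_mul_le_two_pow_mul (contDiff_infty.1 ha' i)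
        (contDiff_infty.1 hgy i) fun j hj => ?_
      rw [norm_iteratedFDeriv_comp_const_sub g (i - j) y x]
      exact mul_le_mul (haA j (hj.trans hi) x hx) (hgB _ (by omega) x hx) (norm_nonneg _) hA
    _ ≤ 2 ^ m * A * B := by
      rw [mul_assoc]
      gcongr
      exact one_le_two

theorem contDiff_fderiv_apply_const (hg : ContDiff ℝ ∞ g) (v : Space d) :
    ContDiff ℝ ∞ (fun z => fderiv ℝ g z v) :=
  (hg.fderiv_right (by simp)).clm_apply contDiff_const

theorem conv_taylorRemainder (ha : IsTest Ω a) (hg : ContDiff ℝ ∞ g) (h y : Space d) :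
    conv T a (taylorRemainder g h) y
      = conv T a g (y + h) - conv T a g y - conv T a (fun z => fderiv ℝ g z h) y := by
  have hgh : ContDiff ℝ ∞ (fun z => g (z + h)) := hg.comp (contDiff_id.add contDiff_const)
  unfold taylorRemainder
  rw [conv_sub T ha (hgh.sub hg) (contDiff_fderiv_apply_const hg h), conv_sub T ha hgh hg]
  simp only [conv, sub_add_eq_add_sub]

theorem eventually_norm_conv_taylorRemainder_le (ha : IsTest Ω a) (hg : ContDiff ℝ ∞ g)
    (y : Space d) {c : ℝ} (hc : 0 < c) :
    ∀ᶠ h in 𝓝 (0 : Space d), ‖conv T a (taylorRemainder g h) y‖ ≤ c * ‖h‖ := by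
  obtain ⟨C, hC, m, hTC⟩ := exists_norm_conv_le T ha
  have hK : IsCompact ((fun x => y - x) '' tsupport a) := ha.2.1.isCompact.image (by fun_prop)
  have hremainder : ∀ᶠ h in 𝓝 (0 : Space d), ∀ j ∈ Iic m, ∀ z ∈ (fun x => y - x) '' tsupport a,
      ‖iteratedFDeriv ℝ j (taylorRemainder g h) z‖ ≤ c / (C + 1) * ‖h‖ :=
    (finite_Iic m).eventually_all.2 fun j _ =>
      eventually_norm_iteratedFDeriv_taylorRemainder_le j (contDiff_infty.1 hg (j + 1)) hK
        (by positivity)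
  filter_upwards [hremainder] with h hh
  calc
    _ ≤ C * (c / (C + 1) * ‖h‖) :=
      hTC _ (contDiff_taylorRemainder (by simpa using hg) h) y _ (by positivity)
        fun j hj x hx => hh j hj _ (mem_image_of_mem _ hx)
    _ = c * (C / (C + 1)) * ‖h‖ := by ring
    _ ≤ c * 1 * ‖h‖ := by
      gcongr
      exact div_le_one_of_le₀ (by linarith) (by linarith)
    _ = c * ‖h‖ := by rw [mul_one]

theorem exists_hasFDerivAt_conv (ha : IsTest Ω a) (hg : ContDiff ℝ ∞ g) (y : Space d) :
    ∃ D : Space d →L[ℝ] ℂ, HasFDerivAt (conv T a g) D y ∧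
      ∀ v, D v = conv T a (fun z => fderiv ℝ g z v) y := by
  let D : Space d →ₗ[ℝ] ℂ :=
    { toFun := fun v => conv T a (fun z => fderiv ℝ g z v) y
      map_add' := fun v w => by
        simpa only [map_add] using conv_add T ha (contDiff_fderiv_apply_const hg v)
          (contDiff_fderiv_apply_const hg w) y
      map_smul' := fun c v => by
        simpa only [map_smul, RingHom.id_apply] using
          conv_smul T ha (contDiff_fderiv_apply_const hg v) c y }
  refine ⟨D.toContinuousLinearMap, ?_, fun v => rfl⟩
  rw [hasFDerivAt_iff_isLittleO_nhds_zero, Asymptotics.isLittleO_iff]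
  intro c hc
  filter_upwards [eventually_norm_conv_taylorRemainder_le T ha hg y hc] with h hh
  rwa [conv_taylorRemainder T ha hg] at hh

theorem differentiable_conv (ha : IsTest Ω a) (hg : ContDiff ℝ ∞ g) :
    Differentiable ℝ (conv T a g) := fun y =>
  let ⟨_, hD, _⟩ := exists_hasFDerivAt_conv T ha hg y
  hD.differentiableAt

theorem fderiv_conv_apply (ha : IsTest Ω a) (hg : ContDiff ℝ ∞ g) (y v : Space d) :
    fderiv ℝ (conv T a g) y v = conv T a (fun z => fderiv ℝ g z v) y := by
  obtain ⟨D, hD, hDv⟩ := exists_hasFDerivAt_conv T ha hg y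
  rw [hD.fderiv, hDv]

theorem contDiff_conv (ha : IsTest Ω a) (hg : ContDiff ℝ ∞ g) : ContDiff ℝ ∞ (conv T a g) := by
  rw [contDiff_infty]
  intro n
  induction n generalizing g with
  | zero => exact contDiff_zero.2 (differentiable_conv T ha hg).continuous
  | succ n ih =>
    push_cast
    rw [contDiff_succ_iff_fderiv_apply]
    refine ⟨differentiable_conv T ha hg, by simp, fun v => ?_⟩
    simpa only [fderiv_conv_apply T ha hg] using ih (contDiff_fderiv_apply_const hg v)

theorem exists_norm_iteratedFDeriv_conv_le (ha : IsTest Ω a) :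
    ∃ C : ℝ, 0 ≤ C ∧ ∃ m : ℕ, ∀ (i : ℕ) (g : Space d → ℂ), ContDiff ℝ ∞ g → ∀ B : ℝ, 0 ≤ B →
      (∀ j ≤ m + i, ∀ z, ‖iteratedFDeriv ℝ j g z‖ ≤ B) →
        ∀ y, ‖iteratedFDeriv ℝ i (conv T a g) y‖ ≤ C * B := by
  obtain ⟨C, hC, m, hTC⟩ := exists_norm_conv_le T ha
  refine ⟨C, hC, m, fun i => ?_⟩
  induction i with
  | zero =>
    intro g hg B hB hgB y
    rw [norm_iteratedFDeriv_zero]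
    exact hTC g hg y B hB fun i hi x _ => hgB i hi _
  | succ i ih =>
    intro g hg B hB hgB y
    refine norm_iteratedFDeriv_succ_le_of_forall_apply
      (contDiff_infty.1 (contDiff_conv T ha hg) (i + 1)) (by positivity) fun v => ?_
    simp only [fderiv_conv_apply T ha hg]
    rw [mul_assoc, mul_comm B]
    refine ih _ (contDiff_fderiv_apply_const hg v) _ (by positivity) (fun j hj z => ?_) y
    calc
      _ ≤ ‖v‖ * ‖iteratedFDeriv ℝ j (fderiv ℝ g) z‖ :=
        norm_iteratedFDeriv_clm_apply_const (hg.fderiv_right (by simp)).contDiffAt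
          (N := ∞) (by exact_mod_cast le_top)
      _ ≤ ‖v‖ * B := by
        rw [norm_iteratedFDeriv_fderiv]
        exact mul_le_mul_of_nonneg_left (hgB _ (by omega) z) (norm_nonneg _)

end Convolution

section UniformNets

variable {d : ℕ} {Ω Ω' : Opens (Space d)} {f g : Net d} {a : Space d → ℝ}

/-- Nets of smooth functions which are moderate uniformly on the whole space, and not only on
compact sets. -/
def IsUniformlyModerate (g : Net d) : Prop :=
  (∀ ε, ContDiff ℝ ∞ (g ε)) ∧ ∀ l : ℕ, ∃ q : ℕ, SeminormLittleO univ l g (-(q : ℤ))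

/-- Nets of smooth functions which are negligible uniformly on the whole space, and not only on
compact sets. -/
def IsUniformlyNegligible (g : Net d) : Prop :=
  (∀ ε, ContDiff ℝ ∞ (g ε)) ∧ ∀ l p : ℕ, SeminormLittleO univ l g (p : ℤ)

theorem IsUniformlyModerate.add (hf : IsUniformlyModerate f) (hg : IsUniformlyModerate g) :
    IsUniformlyModerate (f + g) := by
  refine ⟨fun ε => (hf.1 ε).add (hg.1 ε), fun l => ?_⟩
  obtain ⟨q, hq⟩ := hf.2 l
  obtain ⟨q', hq'⟩ := hg.2 l
  exact ⟨max q q', (hq.mono (by simp)).add (Ω := ⊤) subset_rfl (fun ε => (hf.1 ε).contDiffOn)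
    (fun ε => (hg.1 ε).contDiffOn) (hq'.mono (by simp))⟩

theorem IsUniformlyNegligible.isUniformlyModerate (hg : IsUniformlyNegligible g) :
    IsUniformlyModerate g :=
  ⟨hg.1, fun l => ⟨0, hg.2 l 0⟩⟩

theorem exists_seminormLittleO_cutConv (T : Distribution Ω ℂ ⊤) (ha : IsTest Ω a) :
    ∃ m : ℕ, ∀ (l : ℕ) (r : ℤ) (g : Net d), (∀ ε, ContDiff ℝ ∞ (g ε)) →
      SeminormLittleO univ (m + l) g r → SeminormLittleO univ l (cutConv (fun _ => a) g T) r := by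
  obtain ⟨C, hC, m, hTC⟩ := exists_norm_iteratedFDeriv_conv_le T ha
  refine ⟨m, fun l r g hg hgr => ?_⟩
  rw [seminormLittleO_iff_eventually] at hgr ⊢
  intro c hc
  filter_upwards [hgr (c / (C + 1)) (by positivity)] with ε hε i hi y _
  have hε0 : (0 : ℝ) < ε := ε.2.1
  calc
    _ ≤ C * (c / (C + 1) * (ε : ℝ) ^ r) :=
      hTC i (g ε) (hg ε) _ (by positivity) (fun j hj z => hε j (by omega) z trivial) y
    _ = c * (C / (C + 1)) * (ε : ℝ) ^ r := by ring
    _ ≤ c * 1 * (ε : ℝ) ^ r := by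
      gcongr
      exact div_le_one_of_le₀ (by linarith) (by linarith)
    _ = c * (ε : ℝ) ^ r := by rw [mul_one]

theorem IsUniformlyModerate.isModerate_cutConv (hg : IsUniformlyModerate g) (ha : IsTest Ω a)
    (T : Distribution Ω ℂ ⊤) : IsModerate Ω' (cutConv (fun _ => a) g T) := by
  refine ⟨fun ε => (contDiff_conv T ha (hg.1 ε)).contDiffOn, fun l K _ _ => ?_⟩
  obtain ⟨m, hm⟩ := exists_seminormLittleO_cutConv T ha
  obtain ⟨q, hq⟩ := hg.2 (m + l)
  exact ⟨q, (hm l _ g hg.1 hq).mono_set (subset_univ K)⟩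

theorem IsUniformlyNegligible.isNegligible_cutConv (hg : IsUniformlyNegligible g)
    (ha : IsTest Ω a) (T : Distribution Ω ℂ ⊤) : IsNegligible Ω' (cutConv (fun _ => a) g T) := by
  refine ⟨fun ε => (contDiff_conv T ha (hg.1 ε)).contDiffOn, fun l K _ _ p => ?_⟩
  obtain ⟨m, hm⟩ := exists_seminormLittleO_cutConv T ha
  exact (hm l p g hg.1 (hg.2 (m + l) p)).mono_set (subset_univ K)

end UniformNets

section LogEstimates

theorem mul_abs_log_sq_le_four (ε : Eps) : (ε : ℝ) * |Real.log ε| ^ 2 ≤ 4 := by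
  have hε : (0 : ℝ) < ε := ε.2.1
  have hlog := (Real.abs_log_mul_self_rpow_lt ε (1 / 2) hε ε.2.2 (by norm_num)).le
  rw [← Real.sqrt_eq_rpow, abs_mul, abs_of_nonneg (Real.sqrt_nonneg _)] at hlog
  have hsq := pow_le_pow_left₀ (by positivity) hlog 2
  rw [mul_pow, Real.sq_sqrt hε.le] at hsq
  linarith

theorem mul_abs_log_le_one (ε : Eps) : (ε : ℝ) * |Real.log ε| ≤ 1 := by
  have hε : (0 : ℝ) < ε := ε.2.1
  have hlog := (Real.abs_log_mul_self_lt ε hε ε.2.2).le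
  rwa [abs_mul, abs_of_pos hε, mul_comm] at hlog

theorem tendsto_abs_log_eps_atTop : Tendsto (fun ε : Eps => |Real.log ε|) atBot atTop :=
  tendsto_abs_atBot_atTop.comp (Real.tendsto_log_nhdsGT_zero.comp tendsto_coe_eps_atBot)

end LogEstimates

section MollifierNet

variable {d : ℕ} (ρ : SchwartzMap (Space d) ℂ)

theorem contDiff_rhoNet (ε : Eps) : ContDiff ℝ ∞ (rhoNet ρ ε) :=
  contDiff_const.mul ((ρ.smooth ⊤).comp (contDiff_const_smul _))

theorem norm_iteratedFDeriv_rhoNet (ε : Eps) (i : ℕ) (x : Space d) :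
    ‖iteratedFDeriv ℝ i (rhoNet ρ ε) x‖
      = (ε : ℝ)⁻¹ ^ (d + i) * ‖iteratedFDeriv ℝ i ρ ((ε : ℝ)⁻¹ • x)‖ := by
  have hε : (0 : ℝ) < ε := ε.2.1
  have hrho : rhoNet ρ ε = (1 / (ε : ℝ) ^ d) • fun x => ρ ((ε : ℝ)⁻¹ • x) := by
    funext x
    simp [rhoNet]
  have hsmooth : ContDiff ℝ i (fun x => ρ ((ε : ℝ)⁻¹ • x)) :=
    (ρ.smooth i).comp (contDiff_const_smul _)
  rw [hrho, iteratedFDeriv_const_smul_apply hsmooth.contDiffAt,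
    iteratedFDeriv_comp_const_smul _ (ρ.smooth i), norm_smul, norm_smul, norm_pow,
    Real.norm_of_nonneg (by positivity), Real.norm_of_nonneg (by positivity), pow_add, ← mul_assoc]
  simp only [one_div, inv_pow]

theorem isUniformlyModerate_rhoNet : IsUniformlyModerate (rhoNet ρ) := by
  refine ⟨contDiff_rhoNet ρ, fun l => ⟨d + l + 1, .of_forall_exists_le fun i hi =>
    ⟨SchwartzMap.seminorm ℝ 0 i ρ, .of_forall fun ε x _ => ?_⟩⟩⟩
  have hε : (0 : ℝ) < ε := ε.2.1
  calc
    _ = (ε : ℝ)⁻¹ ^ (d + i) * ‖iteratedFDeriv ℝ i ρ ((ε : ℝ)⁻¹ • x)‖ :=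
      norm_iteratedFDeriv_rhoNet ρ ε i x
    _ ≤ (ε : ℝ)⁻¹ ^ (d + l) * SchwartzMap.seminorm ℝ 0 i ρ := by
      gcongr
      · exact one_le_inv_iff₀.2 ε.2
      · exact SchwartzMap.norm_iteratedFDeriv_le_seminorm ℝ ρ i _
    _ = SchwartzMap.seminorm ℝ 0 i ρ * (ε : ℝ) ^ (-((d + l + 1 : ℕ) : ℤ) + 1) := by
      rw [mul_comm, inv_pow, ← zpow_natCast, ← zpow_neg]
      congr 2
      push_cast
      ring

theorem exists_norm_iteratedFDeriv_rhoNet_le_of_one_le (i p : ℕ) :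
    ∃ C : ℝ, 0 ≤ C ∧ ∀ (ε : Eps) (x : Space d), 1 ≤ |Real.log ε| * ‖x‖ →
      ‖iteratedFDeriv ℝ i (rhoNet ρ ε) x‖ ≤ C * (ε : ℝ) ^ p := by
  set N := p + (d + i) with hN
  refine ⟨4 ^ N * SchwartzMap.seminorm ℝ (2 * N) i ρ, by positivity, fun ε x hx => ?_⟩
  have hε : (0 : ℝ) < ε := ε.2.1
  set z := (ε : ℝ)⁻¹ • x
  have hxz : x = (ε : ℝ) • z := (smul_inv_smul₀ hε.ne' x).symm
  have hfar : 1 ≤ 4 * ε * ‖z‖ ^ 2 :=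
    calc
      (1 : ℝ) ≤ (|Real.log ε| * ‖x‖) ^ 2 := one_le_pow₀ hx
      _ = ε * |Real.log ε| ^ 2 * (ε * ‖z‖ ^ 2) := by
        rw [hxz, norm_smul, Real.norm_of_nonneg hε.le]
        ring
      _ ≤ 4 * (ε * ‖z‖ ^ 2) := by
        gcongr
        exact mul_abs_log_sq_le_four ε
      _ = 4 * ε * ‖z‖ ^ 2 := by ring
  calc
    _ = (ε : ℝ)⁻¹ ^ (d + i) * ‖iteratedFDeriv ℝ i ρ z‖ := norm_iteratedFDeriv_rhoNet ρ ε i x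
    _ ≤ (ε : ℝ)⁻¹ ^ (d + i) * ((4 * ε * ‖z‖ ^ 2) ^ N * ‖iteratedFDeriv ℝ i ρ z‖) := by
      gcongr
      exact le_mul_of_one_le_left (norm_nonneg _) (one_le_pow₀ hfar)
    _ = 4 ^ N * (‖z‖ ^ (2 * N) * ‖iteratedFDeriv ℝ i ρ z‖) * (ε : ℝ) ^ p := by
      rw [mul_pow, mul_pow, ← pow_mul, hN, pow_add (ε : ℝ), inv_pow]
      field_simp
    _ ≤ _ := by
      gcongr
      exact SchwartzMap.le_seminorm ℝ (2 * N) i ρ z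

end MollifierNet

section Cutoff

variable {d : ℕ} {χ : Space d → ℝ}

theorem IsCutoff.contDiff_sub_one (hχ : IsCutoff χ) : ContDiff ℝ ∞ (fun x => (χ x : ℂ) - 1) :=
  (Complex.ofRealCLM.contDiff.comp hχ.isTest.1).sub contDiff_const

theorem IsCutoff.exists_norm_iteratedFDeriv_sub_one_le (hχ : IsCutoff χ) (i : ℕ) :
    ∃ C : ℝ, 0 ≤ C ∧ ∀ x, ‖iteratedFDeriv ℝ i (fun x => (χ x : ℂ) - 1) x‖ ≤ C := by
  obtain ⟨C, hC, hC_le⟩ := exists_forall_norm_iteratedFDeriv_le (n := i)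
    (hχ.contDiff_sub_one.of_le (by exact_mod_cast le_top)) hχ.isTest.2.1.isCompact
  refine ⟨max C ‖(-1 : ℂ)‖, by positivity, fun x => ?_⟩
  by_cases hx : x ∈ tsupport χ
  · exact (hC_le i le_rfl x hx).trans (le_max_left _ _)
  · have hconst : (fun x => (χ x : ℂ) - 1) =ᶠ[𝓝 x] fun _ => -1 := by
      filter_upwards [notMem_tsupport_iff_eventuallyEq.1 hx] with y hy
      simp [hy]
    rw [(hconst.iteratedFDeriv ℝ i).eq_of_nhds]
    exact (norm_iteratedFDeriv_const_le _ i x).trans (le_max_right _ _)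

theorem IsCutoff.exists_norm_iteratedFDeriv_comp_smul_sub_one_le (hχ : IsCutoff χ) (i : ℕ) :
    ∃ C : ℝ, 0 ≤ C ∧ ∀ (L : ℝ) (x : Space d),
      ‖iteratedFDeriv ℝ i (fun x => (χ (L • x) : ℂ) - 1) x‖ ≤ C * |L| ^ i := by
  obtain ⟨C, hC, hC_le⟩ := hχ.exists_norm_iteratedFDeriv_sub_one_le i
  refine ⟨C, hC, fun L x => ?_⟩
  rw [iteratedFDeriv_comp_const_smul (f := fun x => (χ x : ℂ) - 1) _
    (hχ.contDiff_sub_one.of_le (by exact_mod_cast le_top)), norm_smul, norm_pow, Real.norm_eq_abs,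
    mul_comm]
  exact mul_le_mul_of_nonneg_right (hC_le _) (by positivity)

theorem IsCutoff.iteratedFDeriv_comp_smul_sub_one_eq_zero (hχ : IsCutoff χ) {L : ℝ} {x : Space d}
    (hx : |L| * ‖x‖ < 1) (i : ℕ) :
    iteratedFDeriv ℝ i (fun x => (χ (L • x) : ℂ) - 1) x = 0 := by
  have hopen : IsOpen {y : Space d | |L| * ‖y‖ < 1} := isOpen_lt (by fun_prop) continuous_const
  have hzero : (fun x => (χ (L • x) : ℂ) - 1) =ᶠ[𝓝 x] fun _ => 0 := by
    filter_upwards [hopen.mem_nhds hx] with y hy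
    have hLy : L • y ∈ Metric.closedBall (0 : Space d) 1 := by
      rw [mem_closedBall_zero_iff, norm_smul]
      exact hy.le
    rw [hχ.eq_one _ hLy, Complex.ofReal_one, sub_self]
  rw [(hzero.iteratedFDeriv ℝ i).eq_of_nhds, iteratedFDeriv_fun_zero, Pi.zero_apply]

end Cutoff

section ThetaNet

variable {d : ℕ} (ρ : SchwartzMap (Space d) ℂ) {χ : Space d → ℝ}

theorem thetaNet_of_ne_one {ε : Eps} (hε : (ε : ℝ) ≠ 1) :
    thetaNet ρ χ ε = fun x => rhoNet ρ ε x * (χ (|Real.log ε| • x) : ℂ) := by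
  funext x
  simp [thetaNet, hε]

theorem contDiff_thetaNet (hχ : IsCutoff χ) (ε : Eps) : ContDiff ℝ ∞ (thetaNet ρ χ ε) := by
  by_cases hε : (ε : ℝ) = 1
  · have hone : thetaNet ρ χ ε = fun _ => 1 := by
      funext x
      simp [thetaNet, hε]
    exact hone ▸ contDiff_const
  · rw [thetaNet_of_ne_one ρ hε]
    exact (contDiff_rhoNet ρ ε).mul
      (Complex.ofRealCLM.contDiff.comp (hχ.isTest.1.comp (contDiff_const_smul _)))

theorem exists_norm_iteratedFDeriv_rhoNet_mul_le (hχ : IsCutoff χ) (j k p : ℕ) :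
    ∃ C : ℝ, ∀ (ε : Eps) (x : Space d), ‖iteratedFDeriv ℝ j (rhoNet ρ ε) x‖ *
      ‖iteratedFDeriv ℝ k (fun x => (χ (|Real.log ε| • x) : ℂ) - 1) x‖ ≤ C * (ε : ℝ) ^ p := by
  obtain ⟨R, hR, hR_le⟩ := exists_norm_iteratedFDeriv_rhoNet_le_of_one_le ρ j (p + k)
  obtain ⟨X, hX, hX_le⟩ := hχ.exists_norm_iteratedFDeriv_comp_smul_sub_one_le k
  refine ⟨R * X, fun ε x => ?_⟩
  have hε : (0 : ℝ) < ε := ε.2.1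
  rcases lt_or_ge (|Real.log ε| * ‖x‖) 1 with hx | hx
  · rw [hχ.iteratedFDeriv_comp_smul_sub_one_eq_zero (by rwa [abs_abs]), norm_zero, mul_zero]
    positivity
  · calc
      _ ≤ R * (ε : ℝ) ^ (p + k) * (X * |Real.log ε| ^ k) := by
        gcongr
        · exact hR_le ε x hx
        · simpa only [abs_abs] using hX_le |Real.log ε| x
      _ = R * X * (ε : ℝ) ^ p * (ε * |Real.log ε|) ^ k := by ring
      _ ≤ R * X * (ε : ℝ) ^ p :=
        mul_le_of_le_one_right (by positivity)
          (pow_le_one₀ (by positivity) (mul_abs_log_le_one ε))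

theorem isUniformlyNegligible_thetaNet_sub_rhoNet (hχ : IsCutoff χ) :
    IsUniformlyNegligible (thetaNet ρ χ - rhoNet ρ) := by
  refine ⟨fun ε => (contDiff_thetaNet ρ hχ ε).sub (contDiff_rhoNet ρ ε),
    fun l p => .of_forall_exists_le fun i _ => ?_⟩
  choose C hC using fun j => exists_norm_iteratedFDeriv_rhoNet_mul_le ρ hχ j (i - j) (p + 1)
  obtain ⟨B, hB⟩ := ((finite_Iic i).image C).bddAbove
  refine ⟨2 ^ i * B, ?_⟩
  filter_upwards [eventually_eps_lt one_pos] with ε hε x _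
  have hε0 : (0 : ℝ) < ε := ε.2.1
  have hsub : (thetaNet ρ χ - rhoNet ρ) ε
      = fun x => rhoNet ρ ε x * ((χ (|Real.log ε| • x) : ℂ) - 1) := by
    funext x
    simp only [Pi.sub_apply, thetaNet_of_ne_one ρ hε.ne, mul_sub, mul_one]
  have hi : ((i : ℕ) : ℕ∞ω) ≤ ∞ := by exact_mod_cast le_top
  rw [hsub, mul_assoc, ← Nat.cast_succ, zpow_natCast]
  refine norm_iteratedFDeriv_mul_le_two_pow_mul ((contDiff_rhoNet ρ ε).of_le hi)
    ((hχ.contDiff_sub_one.comp (contDiff_const_smul _)).of_le hi) fun j hj => ?_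
  exact (hC j ε x).trans
    (mul_le_mul_of_nonneg_right (hB (mem_image_of_mem C hj)) (by positivity))

theorem isUniformlyModerate_thetaNet (hχ : IsCutoff χ) : IsUniformlyModerate (thetaNet ρ χ) :=
  sub_add_cancel (thetaNet ρ χ) (rhoNet ρ) ▸
    (isUniformlyNegligible_thetaNet_sub_rhoNet ρ hχ).isUniformlyModerate.add
      (isUniformlyModerate_rhoNet ρ)

theorem tendsto_support_thetaNet (hχ : IsCutoff χ) :
    Tendsto (fun ε => Function.support (thetaNet ρ χ ε)) atBot (𝓝 0).smallSets := by
  refine tendsto_smallSets_iff.2 fun t ht => ?_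
  obtain ⟨r, hr, hrt⟩ := Metric.mem_nhds_iff.1 ht
  filter_upwards [eventually_eps_lt one_pos, tendsto_abs_log_eps_atTop.eventually_ge_atTop (2 / r)]
    with ε hε hlog x hx
  refine hrt (by_contra fun hxr => hx ?_)
  rw [mem_ball_zero_iff, not_lt] at hxr
  have hfar : |Real.log ε| • x ∉ Metric.ball (0 : Space d) 2 := by
    rw [mem_ball_zero_iff, not_lt, norm_smul, Real.norm_eq_abs, abs_abs]
    calc
      2 = 2 / r * r := by field_simp
      _ ≤ |Real.log ε| * ‖x‖ := by gcongr
  simp only [thetaNet_of_ne_one ρ hε.ne, hχ.eq_zero _ hfar, Complex.ofReal_zero, mul_zero]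

end ThetaNet

section EventuallyOneNear

variable {d : ℕ} {Ω : Opens (Space d)} {K : Set (Space d)}

/-- For small `ε` the cutoffs `a_ε` are equal to `1` on a neighbourhood of `K` which does not depend
on `ε`. -/
def EventuallyOneNear (a : Eps → Space d → ℝ) (K : Set (Space d)) : Prop :=
  ∀ᶠ p : Eps × Space d in atBot ×ˢ 𝓝ˢ K, a p.1 p.2 = 1

theorem eventuallyOneNear_const {a : Space d → ℝ} (h : ∀ᶠ x in 𝓝ˢ K, a x = 1) :
    EventuallyOneNear (fun _ => a) K :=
  h.prod_inr atBot

theorem eventually_mem_exhaustion {x : Space d} (hx : x ∈ Ω) :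
    ∀ᶠ p : Eps × Space d in atBot ×ˢ 𝓝 x, p.2 ∈ exhaustion Ω p.1 := by
  have hdist_pos : 0 < Metric.infEDist x (Ω : Set (Space d))ᶜ := by
    rw [Metric.infEDist_pos_iff_notMem_closure, Ω.isOpen.isClosed_compl.closure_eq,
      notMem_compl_iff]
    exact hx
  have heps : Tendsto (fun ε : Eps => ENNReal.ofReal ε) atBot (𝓝 0) := by
    simpa using! ENNReal.tendsto_ofReal (tendsto_coe_eps_atBot.mono_right nhdsWithin_le_nhds)
  have hinv : Tendsto (fun ε : Eps => 1 / (ε : ℝ)) atBot atTop := by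
    simpa using! tendsto_inv_nhdsGT_zero.comp tendsto_coe_eps_atBot
  have hdist : ∀ᶠ p : Eps × Space d in atBot ×ˢ 𝓝 x,
      ENNReal.ofReal p.1 < Metric.infEDist p.2 (Ω : Set (Space d))ᶜ :=
    (heps.comp tendsto_fst).eventually_lt
      ((Metric.continuous_infEDist.tendsto x).comp tendsto_snd) hdist_pos
  have hnear : ∀ᶠ y in 𝓝 x, dist y 0 < dist x 0 + 1 :=
    (continuous_id.dist continuous_const).tendsto x |>.eventually_lt_const (lt_add_one _)
  have hmem : ∀ᶠ y in 𝓝 x, y ∈ Ω := Ω.isOpen.mem_nhds hx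
  filter_upwards [hmem.prod_inr atBot, hdist,
    hnear.prod_inr atBot, (hinv.eventually_ge_atTop (dist x 0 + 1)).prod_inl (𝓝 x)]
    with p hpΩ hpdist hpnear hpinv
  exact ⟨hpΩ, hpdist.le, hpnear.le.trans hpinv⟩

theorem IsCutoffNet.eventuallyOneNear {κ : Eps → Space d → ℝ} (hκ : IsCutoffNet Ω κ)
    (hK : IsCompact K) (hKΩ : K ⊆ Ω) : EventuallyOneNear κ K :=
  hK.mem_prod_nhdsSet_of_forall fun _ hx =>
    (eventually_mem_exhaustion (hKΩ hx)).mono fun p hp => hκ.eq_one p.1 p.2 hp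

end EventuallyOneNear

section ConvNet

variable {d : ℕ} {Ω Ω' : Opens (Space d)} {K : Set (Space d)} {f g h : Net d}

/-- The net `T * g_ε`, that is, `(T * g_ε)(y) = ⟨T, g_ε(y - ·)⟩`. Its values are meaningful only at
those `y` for which `g_ε(y - ·)` is a test function on `Ω`. -/
noncomputable def convNet (g : Net d) (T : Distribution Ω ℂ ⊤) : Net d :=
  fun ε y => pairing T (fun x => g ε (y - x))

/-- Two nets which, on a neighbourhood of each compact subset of `Ω`, are equal for all sufficiently
small `ε`. -/
def LocallyEventuallyEq (Ω : Opens (Space d)) (f g : Net d) : Prop :=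
  ∀ K : Set (Space d), IsCompact K → K ⊆ Ω → ∀ᶠ ε in atBot, f ε =ᶠ[𝓝ˢ K] g ε

theorem LocallyEventuallyEq.symm (hfg : LocallyEventuallyEq Ω f g) : LocallyEventuallyEq Ω g f :=
  fun K hK hKΩ => (hfg K hK hKΩ).mono fun _ => EventuallyEq.symm

theorem LocallyEventuallyEq.trans (hfg : LocallyEventuallyEq Ω f g)
    (hgh : LocallyEventuallyEq Ω g h) : LocallyEventuallyEq Ω f h := fun K hK hKΩ => by
  filter_upwards [hfg K hK hKΩ, hgh K hK hKΩ] with ε using EventuallyEq.trans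

theorem LocallyEventuallyEq.restrict (hΩ : Ω' ≤ Ω) (hfg : LocallyEventuallyEq Ω f g) :
    LocallyEventuallyEq Ω' f g :=
  fun K hK hKΩ => hfg K hK (hKΩ.trans hΩ)

theorem LocallyEventuallyEq.isNegligible_sub (hfg : LocallyEventuallyEq Ω f g)
    (hf : ∀ ε, ContDiffOn ℝ ∞ (f ε) (Ω : Set (Space d)))
    (hg : ∀ ε, ContDiffOn ℝ ∞ (g ε) (Ω : Set (Space d))) : IsNegligible Ω (f - g) := by
  refine ⟨fun ε => (hf ε).sub (hg ε), fun l K hK hKΩ p =>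
    (IsNegligible.zero.2 l K hK hKΩ p).congr ((hfg K hK hKΩ).mono fun ε hε => ?_)⟩
  filter_upwards [hε] with y hy
  exact (sub_eq_zero.2 hy).symm

theorem eventually_sub_of_eventually_nhdsSet {G : Type*} [TopologicalSpace G] [AddGroup G]
    [IsTopologicalAddGroup G] {K : Set G} (hK : IsCompact K) {p : G → Prop}
    (h : ∀ᶠ x in 𝓝ˢ K, p x) : ∀ᶠ q : G × G in 𝓝ˢ K ×ˢ 𝓝 0, p (q.1 - q.2) := by
  have hsub : Tendsto (fun q : G × G => q.1 - q.2) (𝓝ˢ (K ×ˢ {0})) (𝓝ˢ K) :=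
    continuous_sub.tendsto_nhdsSet fun q ⟨hq, hq0⟩ => by
      simpa only [mem_singleton_iff.1 hq0, sub_zero] using hq
  rw [hK.nhdsSet_prod_eq isCompact_singleton, nhdsSet_singleton] at hsub
  exact hsub.eventually h

theorem conv_eq_pairing (T : Distribution Ω ℂ ⊤) {a : Space d → ℝ} {g : Space d → ℂ} {y : Space d}
    (h : ∀ x, g (y - x) ≠ 0 → a x = 1) : conv T a g y = pairing T (fun x => g (y - x)) := by
  refine congrArg (pairing T) (funext fun x => ?_)
  by_cases hx : g (y - x) = 0
  · rw [hx, mul_zero]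
  · rw [h x hx, Complex.ofReal_one, one_mul]

theorem EventuallyOneNear.cutConv_eventuallyEq {a : Eps → Space d → ℝ}
    (ha : EventuallyOneNear a K) (hK : IsCompact K)
    (hg : Tendsto (fun ε => Function.support (g ε)) atBot (𝓝 0).smallSets)
    (T : Distribution Ω ℂ ⊤) : ∀ᶠ ε in atBot, cutConv a g T ε =ᶠ[𝓝ˢ K] convNet g T ε := by
  obtain ⟨P, hP, Q, hQ, ha_one⟩ := eventually_prod_iff.1 ha
  obtain ⟨Y, hY, Z, hZ, hYZ⟩ := eventually_prod_iff.1 (eventually_sub_of_eventually_nhdsSet hK hQ)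
  filter_upwards [hP, tendsto_smallSets_iff.1 hg {z | Z z} hZ] with ε hPε hsupp
  filter_upwards [hY] with y hy
  refine conv_eq_pairing T fun x hx => ha_one hPε ?_
  simpa only [sub_sub_cancel] using hYZ hy (hsupp hx)

theorem contDiffOn_pairing_comp_sub (T : Distribution Ω ℂ ⊤) {V : Set (Space d)}
    {g : Space d → ℂ} (hg : ContDiff ℝ ∞ g) (h : ∀ y ∈ V, IsTest Ω (fun x => g (y - x))) :
    ContDiffOn ℝ ∞ (fun y => pairing T (fun x => g (y - x))) V := by
  intro y hy
  obtain ⟨-, hcompact, hsub⟩ := h y hy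
  obtain ⟨a, ha, ha_one⟩ := exists_isTest_eventually_eq_one hcompact hsub
  have hshift : ∀ᶠ z in 𝓝 (0 : Space d), ∀ k ∈ tsupport fun x => g (y - x), a (k - z) = 1 :=
    (tendsto_prod_swap.eventually (eventually_sub_of_eventually_nhdsSet hcompact ha_one)).curry.mono
      fun _ hz => hz.self_of_nhdsSet
  have htendsto : Tendsto (fun y' => y - y') (𝓝 y) (𝓝 0) :=
    Continuous.tendsto' (by fun_prop) y 0 (sub_self y)
  refine ((contDiff_conv T ha hg).contDiffAt.congr_of_eventuallyEq ?_).contDiffWithinAt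
  filter_upwards [htendsto.eventually hshift] with y' hy'
  refine (conv_eq_pairing T fun x hx => ?_).symm
  have hmem : x + (y - y') ∈ tsupport fun x => g (y - x) := by
    refine subset_tsupport _ ?_
    rwa [Function.mem_support, ← sub_sub, sub_right_comm, sub_sub_cancel]
  simpa only [add_sub_cancel_right] using hy' _ hmem

theorem LocallyEventuallyEq.isModerate {T : Distribution Ω ℂ ⊤} (hΩ : Ω' ≤ Ω)
    (hfg : LocallyEventuallyEq Ω' f (convNet g T)) (hg : IsUniformlyModerate g)
    (hsupp : Tendsto (fun ε => Function.support (g ε)) atBot (𝓝 0).smallSets)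
    (hf : ∀ ε, ContDiffOn ℝ ∞ (f ε) (Ω' : Set (Space d))) : IsModerate Ω' f := by
  refine ⟨hf, fun l K hK hKΩ => ?_⟩
  obtain ⟨a, ha, ha_one⟩ := exists_isTest_eventually_eq_one hK (hKΩ.trans hΩ)
  obtain ⟨q, hq⟩ := (hg.isModerate_cutConv (Ω' := Ω') ha T).2 l K hK hKΩ
  refine ⟨q, hq.congr ?_⟩
  filter_upwards [(eventuallyOneNear_const ha_one).cutConv_eventuallyEq hK hsupp T, hfg K hK hKΩ]
    with ε ha_eq hf_eq
  exact ha_eq.trans hf_eq.symm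

end ConvNet

section Representatives

variable {d : ℕ} {Ω Ω' : Opens (Space d)} {g g' : Net d} {κ : Eps → Space d → ℝ} {L : Type*}
  {U : L → Opens (Space d)} {ψ : L → Space d → ℝ} {e : L → Eps} (T : Distribution Ω ℂ ⊤)

theorem contDiff_cutConv {a : Eps → Space d → ℝ} (ha : ∀ ε, IsTest Ω (a ε))
    (hg : ∀ ε, ContDiff ℝ ∞ (g ε)) (ε : Eps) : ContDiff ℝ ∞ (cutConv a g T ε) :=
  contDiff_conv T (ha ε) (hg ε)

theorem IsThreshold.contDiffOn_localNet (he : IsThreshold Ω g U e) (hg : ∀ ε, ContDiff ℝ ∞ (g ε))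
    (l : L) (ε : Eps) : ContDiffOn ℝ ∞ (localNet g (e l) T ε) (U l : Set (Space d)) :=
  contDiffOn_pairing_comp_sub T (hg _) fun y hy => he l _ (min_le_right ε (e l).sq) y hy

theorem locallyEventuallyEq_localNet (e : Eps) :
    LocallyEventuallyEq Ω' (localNet g e T) (convNet g T) := fun K _ _ => by
  filter_upwards [eventually_le_atBot e.sq] with ε hε
  have hmin : min ε e.sq = ε := min_eq_left hε
  exact .of_eq (congrArg (convNet g T) hmin)

theorem IsCutoffNet.locallyEventuallyEq_cutConv (hκ : IsCutoffNet Ω κ)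
    (hsupp : Tendsto (fun ε => Function.support (g ε)) atBot (𝓝 0).smallSets) :
    LocallyEventuallyEq Ω (cutConv κ g T) (convNet g T) :=
  fun _ hK hKΩ => (hκ.eventuallyOneNear hK hKΩ).cutConv_eventuallyEq hK hsupp T

theorem IsPlateau.locallyEventuallyEq_cutConv (hψ : IsPlateau Ω U ψ)
    (hsupp : Tendsto (fun ε => Function.support (g ε)) atBot (𝓝 0).smallSets) (l : L) :
    LocallyEventuallyEq (U l) (cutConv (fun _ => ψ l) g T) (convNet g T) := fun _ hK hKU =>
  (eventuallyOneNear_const ((hψ.eq_one l).filter_mono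
    (nhdsSet_mono (hKU.trans subset_closure)))).cutConv_eventuallyEq hK hsupp T

theorem IsCutoffNet.isModerate_cutConv (hκ : IsCutoffNet Ω κ) (hg : IsUniformlyModerate g)
    (hsupp : Tendsto (fun ε => Function.support (g ε)) atBot (𝓝 0).smallSets) :
    IsModerate Ω (cutConv κ g T) :=
  (hκ.locallyEventuallyEq_cutConv T hsupp).isModerate le_rfl hg hsupp
    fun ε => (contDiff_cutConv T hκ.isTest hg.1 ε).contDiffOn

theorem IsThreshold.isModerate_localNet (he : IsThreshold Ω g U e) (hU : IsCovering Ω U)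
    (hg : IsUniformlyModerate g)
    (hsupp : Tendsto (fun ε => Function.support (g ε)) atBot (𝓝 0).smallSets) (l : L) :
    IsModerate (U l) (localNet g (e l) T) :=
  (locallyEventuallyEq_localNet T (e l)).isModerate (hU.le l) hg hsupp
    (he.contDiffOn_localNet T hg.1 l)

theorem IsCutoffNet.isNegligible_cutConv_sub_localNet (hκ : IsCutoffNet Ω κ)
    (hU : IsCovering Ω U) (he : IsThreshold Ω g U e) (hg : ∀ ε, ContDiff ℝ ∞ (g ε))
    (hsupp : Tendsto (fun ε => Function.support (g ε)) atBot (𝓝 0).smallSets) (l : L) :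
    IsNegligible (U l) (cutConv κ g T - localNet g (e l) T) :=
  (((hκ.locallyEventuallyEq_cutConv T hsupp).restrict (hU.le l)).trans
    (locallyEventuallyEq_localNet T (e l)).symm).isNegligible_sub
      (fun ε => (contDiff_cutConv T hκ.isTest hg ε).contDiffOn) (he.contDiffOn_localNet T hg l)

theorem IsUniformlyNegligible.isNegligible_cutConv_sub_cutConv {a : Space d → ℝ}
    (h : IsUniformlyNegligible (g - g')) (ha : IsTest Ω a) (hg : ∀ ε, ContDiff ℝ ∞ (g ε))
    (hg' : ∀ ε, ContDiff ℝ ∞ (g' ε)) :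
    IsNegligible Ω' (cutConv (fun _ => a) g T - cutConv (fun _ => a) g' T) := by
  have hsub : cutConv (fun _ => a) (g - g') T =
      cutConv (fun _ => a) g T - cutConv (fun _ => a) g' T :=
    funext fun ε => funext fun y => conv_sub T ha (hg ε) (hg' ε) y
  exact hsub ▸ h.isNegligible_cutConv ha T

theorem IsCutoffNet.isNegligible_cutConv_sub_cutConv (hκ : IsCutoffNet Ω κ)
    (hU : IsCovering Ω U) (hψ : IsPlateau Ω U ψ) (h : IsUniformlyNegligible (g - g'))
    (hg : ∀ ε, ContDiff ℝ ∞ (g ε)) (hg' : ∀ ε, ContDiff ℝ ∞ (g' ε))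
    (hsupp : Tendsto (fun ε => Function.support (g ε)) atBot (𝓝 0).smallSets) (l : L) :
    IsNegligible (U l) (cutConv κ g T - cutConv (fun _ => ψ l) g' T) := by
  have hcutoff : IsNegligible (U l) (cutConv κ g T - cutConv (fun _ => ψ l) g T) :=
    (((hκ.locallyEventuallyEq_cutConv T hsupp).restrict (hU.le l)).trans
      (hψ.locallyEventuallyEq_cutConv T hsupp l).symm).isNegligible_sub
        (fun ε => (contDiff_cutConv T hκ.isTest hg ε).contDiffOn)
        (fun ε => (contDiff_cutConv T (fun _ => hψ.isTest l) hg ε).contDiffOn)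
  have hkernel := h.isNegligible_cutConv_sub_cutConv (Ω' := U l) T (hψ.isTest l) hg hg'
  exact sub_add_sub_cancel (cutConv κ g T) (cutConv (fun _ => ψ l) g T) _ ▸ hcutoff.add hkernel

end Representatives

section Classes

variable {d : ℕ} {Ω : Opens (Space d)} {f g : Net d}

theorem cls_eq_cls_iff (hf : f ∈ moderate Ω) (hg : g ∈ moderate Ω) :
    cls f hf = cls g hg ↔ IsNegligible Ω (f - g) :=
  Ideal.Quotient.eq

theorem exists_eq_cls (u : ColombeauAlgebra Ω) :
    ∃ (f : Net d) (hf : f ∈ moderate Ω), u = cls f hf := by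
  obtain ⟨⟨f, hf⟩, rfl⟩ := Ideal.Quotient.mk_surjective u
  exact ⟨f, hf, rfl⟩

theorem isNegligible_of_cover {L : Type*} {U : L → Opens (Space d)}
    (hU : ∀ x ∈ Ω, ∃ l, x ∈ U l) (h : ∀ l, IsNegligible (U l) f) : IsNegligible Ω f := by
  refine ⟨fun ε x hx => ?_, fun l K hK hKΩ p => .of_locally hK fun x hx => ?_⟩
  · obtain ⟨i, hi⟩ := hU x hx
    exact (((h i).1 ε).contDiffAt ((U i).isOpen.mem_nhds hi)).contDiffWithinAt
  · obtain ⟨i, hi⟩ := hU x (hKΩ hx)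
    obtain ⟨N, hN, hNU, hN_compact⟩ := local_compact_nhds ((U i).isOpen.mem_nhds hi)
    exact ⟨N, mem_nhdsWithin_of_mem_nhds hN, (h i).2 l N hN_compact hNU p⟩

theorem IsCovering.ext {L : Type*} {U : L → Opens (Space d)} (hU : IsCovering Ω U)
    {u v : ColombeauAlgebra Ω} (h : ∀ l, restriction (hU.le l) u = restriction (hU.le l) v) :
    u = v := by
  obtain ⟨f, hf, rfl⟩ := exists_eq_cls u
  obtain ⟨g, hg, rfl⟩ := exists_eq_cls v
  refine (cls_eq_cls_iff hf hg).2 (isNegligible_of_cover hU.covers fun l => ?_)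
  exact (cls_eq_cls_iff (hf.restrict (hU.le l)) (hg.restrict (hU.le l))).1 (h l)

end Classes

section Embeddings

variable {d : ℕ} {Ω : Opens (Space d)} {L : Type*} {U : L → Opens (Space d)}
  {u : Distribution Ω ℂ ⊤ → ColombeauAlgebra Ω}

theorem IsGivenBy.iff_eq {N : Distribution Ω ℂ ⊤ → Net d} (hu : IsGivenBy N u)
    (v : Distribution Ω ℂ ⊤ → ColombeauAlgebra Ω) : IsGivenBy N v ↔ v = u := by
  refine ⟨fun hv => funext fun T => ?_, fun h => h ▸ hu⟩
  rw [(hu T).choose_spec, (hv T).choose_spec]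

theorem IsGluedFrom.iff_eq {hU : IsCovering Ω U} {N : L → Distribution Ω ℂ ⊤ → Net d}
    (hu : IsGluedFrom hU N u) (v : Distribution Ω ℂ ⊤ → ColombeauAlgebra Ω) :
    IsGluedFrom hU N v ↔ v = u := by
  refine ⟨fun hv => funext fun T => hU.ext fun l => ?_, fun h => h ▸ hu⟩
  rw [(hu l T).choose_spec, (hv l T).choose_spec]

theorem IsGivenBy.isGluedFrom {N : Distribution Ω ℂ ⊤ → Net d} (hu : IsGivenBy N u)
    (hU : IsCovering Ω U) {N' : L → Distribution Ω ℂ ⊤ → Net d}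
    (hmod : ∀ l T, IsModerate (U l) (N' l T)) (hneg : ∀ l T, IsNegligible (U l) (N T - N' l T)) :
    IsGluedFrom hU N' u := fun l T => by
  obtain ⟨hNT, huT⟩ := hu T
  refine ⟨hmod l T, ?_⟩
  rw [huT, restriction_cls]
  exact (cls_eq_cls_iff _ _).2 (hneg l T)

/-- The linear map `T ↦ (aT) * g_ε` from distributions to nets, through which linearity of the
embeddings is inherited by the quotient. -/
noncomputable def cutConvLinear (Ω : Opens (Space d)) (a : Eps → Space d → ℝ) (g : Net d) :
    Distribution Ω ℂ ⊤ →ₗ[ℂ] Net d where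
  toFun := cutConv a g
  map_add' S T := funext fun _ => funext fun _ => pairing_add_left S T _
  map_smul' c T := funext fun _ => funext fun _ => pairing_smul_left T c _

/-- The linear map into the Colombeau algebra induced by a linear map whose values are moderate
nets. -/
noncomputable def clsLinear {E : Type*} [AddCommGroup E] [Module ℂ E] (N : E →ₗ[ℂ] Net d)
    (hN : ∀ x, N x ∈ moderate Ω) : E →ₗ[ℂ] ColombeauAlgebra Ω :=
  (Ideal.Quotient.mkₐ ℂ (negligible Ω)).toLinearMap ∘ₗ
    N.codRestrict (Subalgebra.toSubmodule (moderate Ω)) hN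

end Embeddings

end Colombeau

theorem mainTheorem1_general {d : ℕ} (Ω : Opens (Colombeau.Space d))
    (ρ : SchwartzMap (Colombeau.Space d) ℂ)
    (χ : Colombeau.Space d → ℝ) (hχ : Colombeau.IsCutoff χ)
    (κ : Colombeau.Eps → Colombeau.Space d → ℝ) (hκ : Colombeau.IsCutoffNet Ω κ)
    {L : Type*} (U : L → Opens (Colombeau.Space d)) (hU : Colombeau.IsCovering Ω U)
    (ψ : L → Colombeau.Space d → ℝ) (hψ : Colombeau.IsPlateau Ω U ψ)
    {M : Type*} (V : M → Opens (Colombeau.Space d)) (hV : Colombeau.IsCovering Ω V)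
    (e : M → Colombeau.Eps)
    (he : Colombeau.IsThreshold Ω (Colombeau.thetaNet ρ χ) V e) :
    ∃ ιA ιS ιS' : Distribution Ω ℂ ⊤ →ₗ[ℂ] Colombeau.ColombeauAlgebra Ω,
      (∀ u, Colombeau.IsIotaA ρ hU ψ u ↔ u = ιA) ∧
      (∀ u, Colombeau.IsIotaS ρ χ κ u ↔ u = ιS) ∧
      (∀ u, Colombeau.IsIotaS' ρ χ hV e u ↔ u = ιS') ∧
      ιA = ιS ∧ ιS = ιS' := by
  have hρ := Colombeau.isUniformlyModerate_rhoNet ρ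
  have hθ := Colombeau.isUniformlyModerate_thetaNet ρ hχ
  have hsub := Colombeau.isUniformlyNegligible_thetaNet_sub_rhoNet ρ hχ
  have hsupp := Colombeau.tendsto_support_thetaNet ρ hχ
  have hmod (T) : Colombeau.cutConvLinear Ω κ (Colombeau.thetaNet ρ χ) T ∈ Colombeau.moderate Ω :=
    hκ.isModerate_cutConv T hθ hsupp
  let ι := Colombeau.clsLinear _ hmod
  have hS : Colombeau.IsIotaS ρ χ κ ι := fun T => ⟨hmod T, rfl⟩
  have hA : Colombeau.IsIotaA ρ hU ψ ι := Colombeau.IsGivenBy.isGluedFrom hS hU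
    (fun l T => hρ.isModerate_cutConv (hψ.isTest l) T)
    (fun l T => hκ.isNegligible_cutConv_sub_cutConv T hU hψ hsub hθ.1 hρ.1 hsupp l)
  have hS' : Colombeau.IsIotaS' ρ χ hV e ι := Colombeau.IsGivenBy.isGluedFrom hS hV
    (fun μ T => he.isModerate_localNet T hV hθ hsupp μ)
    (fun μ T => hκ.isNegligible_cutConv_sub_localNet T hV he hθ.1 hsupp μ)
  exact ⟨ι, ι, ι, hA.iff_eq, hS.iff_eq, hS'.iff_eq, rfl, rfl⟩

theorem mainTheorem1 {d : ℕ} (Ω : Opens (Colombeau.Space d))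
    (ρ : SchwartzMap (Colombeau.Space d) ℂ) (hρ : Colombeau.IsMollifier ρ)
    (χ : Colombeau.Space d → ℝ) (hχ : Colombeau.IsCutoff χ)
    (κ : Colombeau.Eps → Colombeau.Space d → ℝ) (hκ : Colombeau.IsCutoffNet Ω κ)
    {L : Type*} (U : L → Opens (Colombeau.Space d)) (hU : Colombeau.IsCovering Ω U)
    (ψ : L → Colombeau.Space d → ℝ) (hψ : Colombeau.IsPlateau Ω U ψ)
    {M : Type*} (V : M → Opens (Colombeau.Space d)) (hV : Colombeau.IsCovering Ω V)
    (e : M → Colombeau.Eps)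
    (he : Colombeau.IsThreshold Ω (Colombeau.thetaNet ρ χ) V e) :
    ∃ ιA ιS ιS' : Distribution Ω ℂ ⊤ →ₗ[ℂ] Colombeau.ColombeauAlgebra Ω,
      (∀ u, Colombeau.IsIotaA ρ hU ψ u ↔ u = ιA) ∧
      (∀ u, Colombeau.IsIotaS ρ χ κ u ↔ u = ιS) ∧
      (∀ u, Colombeau.IsIotaS' ρ χ hV e u ↔ u = ιS') ∧
      ιA = ιS ∧ ιS = ιS' :=
  mainTheorem1_general Ω ρ χ hχ κ hκ U hU ψ hψ V hV e he
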